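/- All Banach spaces are real. For $N\in\mathbb N$ and a family $\mathcal S$ of subsets of $[N]=\{1,\dots,N\}$, let $\mathcal B^N_{\mathcal S}$ be the space of all functions $f\colon\{-1,+1\}^N\to\mathbb R$ whose Fourier–Walsh expansion $f=\sum_{S}\widehat f(S)\chi_S$, $\chi_S(x)=\prod_{k\in S}x_k$, $\widehat f(S)=2^{-N}\sum_x f(x)\chi_S(x)$, is supported on $\mathcal S$, endowed with the supremum norm. Write $\mathcal B^N_{=k}$ for $\mathcal B^N_{\{S\,:\,|S|=k\}}$, and put $\mathcal S_{=k}=\{S\in\mathcal S: |S|=k\}$ and $\mathcal S^\flat=\{S\setminus\{i\}: S\in\mathcal S,\ i\in S\}$. For a Banach space $X$, the projection constant $\boldsymbol\lambda(X)$ is the supremum, over all Banach spaces $Z$ and all linear isometric embeddings $I\colon X\to Z$, of $\inf\{\|P\| : P\colon Z\to I(X)\text{ a bounded linear projection onto } I(X)\}$. For an operator $u\colon X\to Y$, $\pi_1(u)$ is the least $C\ge 0$ such that $\sum_j\|ux_j\|\le C\sup_{\|x^*\|\le1}\sum_j|x^*(x_j)|$ for all finite families $(x_j)$ in $X$ (if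 such a $C$ exists, $u$ is called $1$-summing), and $\gamma_1(u)=\inf\|v\|\|w\|$ over all factorizations $\kappa_Yu=wv$ with $v\colon X\to L_1(\mu)$, $w\colon L_1(\mu)\to Y^{**}$, $\mu$ any measure and $\kappa_Y\colon Y\to Y^{**}$ the canonical embedding ($\gamma_1(u)=\infty$ if there is none). The Gordon–Lewis constant $\boldsymbol{g\!l}(X)$ is the best $C\ge 0$ such that $\gamma_1(u)\le C\,\pi_1(u)$ for all $1$-summing $u\colon X\to\ell_2$. Finally, let $\kappa=\big(\prod_{p\text{ prime}}\frac{\sin(\pi/p)}{\pi/p}\big)^{-1}=2.209\ldots$ **Theorem.** Let $2\le d\le N$. (1) If $\mathcal S\subset\{S\subset[N]:|S|=d\}$, then $$\boldsymbol{g\!l}\big(\mathcal B^N_{\mathcal S}\big)\le 2d\,\kappa^d\,2^{d-1}\ \big\|\mathbf Q\colon\mathcal B^N_{=d}\to\mathcal B^N_{\mathcal S}\big\|\ \boldsymbol\lambda\big(\mathcal B^N_{\mathcal S^\flat}\big),$$ where $\mathbf Q$ is the projection annihilating the Fourier coefficients with indices not in $\mathcal S$. (2) If $\mathcal S\subset\{S\subset[N]:|S|\le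 d\}$ and $\mathcal S\ne\{\emptyset\}$, then $$\boldsymbol{g\!l}\big(\mathcal B^N_{\mathcal S}\big)\le (d+1)(1+\sqrt2)^d\,(2d)\,\kappa^d\,2^d\ \max_{1\le k\le d}\big\|\mathbf Q_k\colon\mathcal B^N_{=k}\to\mathcal B^N_{\mathcal S_{=k}}\big\|\ \max_{1\le k\le d}\boldsymbol\lambda\big(\mathcal B^N_{(\mathcal S_{=k})^\flat}\big),$$ where $\mathbf Q_k$ is the projection annihilating the Fourier coefficients with indices not in $\mathcal S_{=k}$. -/

import Mathlib

set_option maxSynthPendingDepth 3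

open scoped ENNReal NNReal

noncomputable section

namespace BooleanCube

/-! ### Constants from Banach space theory (real scalars, values in `[0, ∞]`) -/

section BanachSpaces

universe u v

/-- The relative projection constant `λ(X, Y)` of a subspace `X` of `Y`: the infimum of `‖P‖`
over all bounded linear projections `P` of `Y` onto `X`. -/
def relProjConst {Y : Type u} [NormedAddCommGroup Y] [NormedSpace ℝ Y]
    (X : Submodule ℝ Y) : ℝ≥0∞ :=
  ⨅ (P : Y →L[ℝ] X) (_ : ∀ x : X, P x = x), ‖P‖ₑ

/-- The (absolute) projection constant `λ(X)`: the supremum of `λ(I(X), Z)` over all Banach spaces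
`Z` and all linear isometric embeddings `I : X → Z`. Taking `Z` in the universe of `X` loses
nothing, since the supremum is attained at `Z = ℓ∞` of the dual unit ball of `X`. -/
def projConst (X : Type u) [NormedAddCommGroup X] [NormedSpace ℝ X] : ℝ≥0∞ :=
  ⨆ (Z : Type u) (_ : NormedAddCommGroup Z) (_ : NormedSpace ℝ Z) (_ : CompleteSpace Z)
    (I : X →ₗᵢ[ℝ] Z), relProjConst (LinearMap.range I.toLinearMap)

variable {X : Type u} [NormedAddCommGroup X] [NormedSpace ℝ X]
variable {Y : Type v} [NormedAddCommGroup Y] [NormedSpace ℝ Y]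

/-- `C` is an admissible constant in the definition of `1`-summing operators:
`∑ ‖a xⱼ‖ ≤ C · sup {∑ |φ xⱼ| : ‖φ‖ ≤ 1}` for all finite families `x₁, …, xₙ` in `X`. -/
def IsOneSummingWith (C : ℝ≥0) (a : X →L[ℝ] Y) : Prop :=
  ∀ (n : ℕ) (x : Fin n → X),
    ∑ j, ‖a (x j)‖ₑ ≤ C * ⨆ (φ : StrongDual ℝ X) (_ : ‖φ‖ ≤ 1), ∑ j, ‖φ (x j)‖ₑ

/-- `a` is `1`-summing. -/
def IsOneSumming (a : X →L[ℝ] Y) : Prop := ∃ C : ℝ≥0, IsOneSummingWith C a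

/-- The `1`-summing norm `π₁(a)`, the least admissible constant. -/
def piOne (a : X →L[ℝ] Y) : ℝ≥0∞ :=
  ⨅ (C : ℝ≥0) (_ : IsOneSummingWith C a), (C : ℝ≥0∞)

/-- The `1`-factorable norm `γ₁(a)`: the infimum of `‖v‖ ‖w‖` over all factorizations
`κ_Y a = w v : X → L₁(μ) → Y**` through some `L₁(μ)`, where `κ_Y : Y → Y**` is the canonical
embedding. It is `∞` if there is no such factorization. -/
def gammaOne (a : X →L[ℝ] Y) : ℝ≥0∞ :=
  ⨅ (Ω : Type u) (_ : MeasurableSpace Ω) (μ : MeasureTheory.Measure Ω)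
    (v : X →L[ℝ] MeasureTheory.Lp ℝ 1 μ)
    (w : MeasureTheory.Lp ℝ 1 μ →L[ℝ] StrongDual ℝ (StrongDual ℝ Y))
    (_ : w.comp v = (NormedSpace.inclusionInDoubleDual ℝ Y).comp a), ‖v‖ₑ * ‖w‖ₑ

/-- The Gordon–Lewis constant `gl(X)`: the best `C` with `γ₁(a) ≤ C π₁(a)` for all `1`-summing
operators `a : X → ℓ₂`; it is `∞` if no finite `C` works. -/
def glConst (X : Type u) [NormedAddCommGroup X] [NormedSpace ℝ X] : ℝ≥0∞ :=
  ⨅ (C : ℝ≥0) (_ : ∀ a : X →L[ℝ] lp (fun _ : ℕ => ℝ) 2, IsOneSumming a →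
    gammaOne a ≤ C * piOne a), (C : ℝ≥0∞)

end BanachSpaces

/-! ### Functions on the Boolean cube -/

/-- The cube `{-1, +1}^N`; the two signs are the units of `ℤ`. -/
abbrev Cube (N : ℕ) : Type := Fin N → ℤˣ

/-- The Walsh function `χ_S(x) = ∏_{k ∈ S} x_k`. -/
def walsh {N : ℕ} (S : Finset (Fin N)) : Cube N → ℝ :=
  fun x => ∏ k ∈ S, ((x k : ℤ) : ℝ)

/-- The Fourier coefficient `f ↦ E[f χ_S]`, the expectation being over the uniform
probability on the cube. -/
def fourierCoeff {N : ℕ} (S : Finset (Fin N)) : (Cube N → ℝ) →ₗ[ℝ] ℝ where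
  toFun f := (1 / 2 ^ N : ℝ) * ∑ x, f x * walsh S x
  map_add' f g := by simp [add_mul, Finset.sum_add_distrib, mul_add]
  map_smul' c f := by
    simp only [Pi.smul_apply, smul_eq_mul, RingHom.id_apply, mul_assoc, ← Finset.mul_sum]
    ring

/-- The space `B^N_𝒮` of functions on the cube whose Fourier–Walsh expansion is supported on `𝒮`.
Its norm is inherited from `Cube N → ℝ`, hence it is the supremum norm. -/
def walshSpace {N : ℕ} (𝒮 : Finset (Finset (Fin N))) : Submodule ℝ (Cube N → ℝ) where
  carrier := {f | ∀ T, T ∉ 𝒮 → fourierCoeff T f = 0}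
  add_mem' hf hg T hT := by rw [map_add, hf T hT, hg T hT, add_zero]
  zero_mem' T _ := map_zero _
  smul_mem' c f hf T hT := by rw [map_smul, hf T hT, smul_zero]

theorem fourierCoeff_walsh {N : ℕ} (S T : Finset (Fin N)) :
    fourierCoeff T (walsh S) = if S = T then 1 else 0 := by
  have key : ∀ x : Cube N, walsh S x * walsh T x =
      ∏ i, ((if i ∈ S then ((x i : ℤ) : ℝ) else 1) * (if i ∈ T then ((x i : ℤ) : ℝ) else 1)) := by
    intro x
    rw [Finset.prod_mul_distrib, Finset.prod_ite_mem, Finset.prod_ite_mem, Finset.univ_inter,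
      Finset.univ_inter]
    rfl
  have key2 : ∑ x : Cube N, walsh S x * walsh T x =
      ∏ i : Fin N, ∑ e : ℤˣ,
        ((if i ∈ S then ((e : ℤ) : ℝ) else 1) * (if i ∈ T then ((e : ℤ) : ℝ) else 1)) := by
    rw [Finset.prod_univ_sum, Fintype.piFinset_univ]
    exact Finset.sum_congr rfl fun x _ => key x
  have two : ∀ g : ℤˣ → ℝ, ∑ e, g e = g 1 + g (-1) := by
    intro g
    rw [show (Finset.univ : Finset ℤˣ) = {1, -1} from rfl, Finset.sum_pair (by decide)]
  change (1 / 2 ^ N : ℝ) * ∑ x, walsh S x * walsh T x = _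
  rw [key2]
  split_ifs with h
  · subst h
    have : ∀ i : Fin N, ∑ e : ℤˣ,
        ((if i ∈ S then ((e : ℤ) : ℝ) else 1) * (if i ∈ S then ((e : ℤ) : ℝ) else 1)) = 2 := by
      intro i
      rw [two]
      split_ifs <;> norm_num
    rw [Finset.prod_congr rfl fun i _ => this i]
    simp
  · obtain ⟨i, hi⟩ : ∃ i, ¬(i ∈ S ↔ i ∈ T) := by
      by_contra hcon
      push Not at hcon
      exact h (Finset.ext hcon)
    rw [Finset.prod_eq_zero (Finset.mem_univ i), mul_zero]
    rw [two]
    by_cases h1 : i ∈ S <;> by_cases h2 : i ∈ T <;> simp_all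

/-- The operator `f ↦ ∑_{S ∈ 𝒮} f̂(S) χ_S` from `B^N_𝒜` to `B^N_𝒮`, which annihilates the Fourier
coefficients with indices not in `𝒮`; it is a projection onto `B^N_𝒮` if `𝒮 ⊆ 𝒜`. Both spaces
are finite dimensional, so it is bounded. -/
def coeffProj {N : ℕ} (𝒜 𝒮 : Finset (Finset (Fin N))) : walshSpace 𝒜 →L[ℝ] walshSpace 𝒮 :=
  LinearMap.toContinuousLinearMap
    (LinearMap.codRestrict (walshSpace 𝒮)
      ((∑ S ∈ 𝒮, (fourierCoeff S).smulRight (walsh S)) ∘ₗ (walshSpace 𝒜).subtype)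
      (by
        intro f T hT
        simp only [LinearMap.coe_comp, Function.comp_apply, LinearMap.sum_apply, map_sum,
          LinearMap.smulRight_apply, map_smul, fourierCoeff_walsh, smul_eq_mul]
        refine Finset.sum_eq_zero fun S hS => ?_
        rw [if_neg (fun h : S = T => hT (h ▸ hS)), mul_zero]))

/-- The family of all `d`-subsets of `[N]`; its Walsh space is `B^N_{=d}`. -/
abbrev homog (N d : ℕ) : Finset (Finset (Fin N)) := Finset.powersetCard d Finset.univ

/-- The family `𝒮^♭ = {S \ {i} : S ∈ 𝒮, i ∈ S}`. -/
def flat {N : ℕ} (𝒮 : Finset (Finset (Fin N))) : Finset (Finset (Fin N)) :=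
  𝒮.biUnion fun S => S.image fun i => S \ {i}

/-- The subfamily `𝒮_{=k}` of the members of `𝒮` with `k` elements. -/
def level {N : ℕ} (𝒮 : Finset (Finset (Fin N))) (k : ℕ) : Finset (Finset (Fin N)) :=
  𝒮.filter fun S => S.card = k

/-- `κ = (∏_p sinc (π / p))⁻¹ = 2.209…`, the product being over all primes. -/
def kappa : ℝ := (∏' p : Nat.Primes, Real.sinc (Real.pi / (p : ℕ)))⁻¹

/-- The product defining `κ` converges. -/
theorem multipliable_sinc_primes :
    Multipliable fun p : Nat.Primes => Real.sinc (Real.pi / (p : ℕ)) := by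
  have bound : ∀ x : ℝ, |Real.sinc x - 1| ≤ x ^ 2 := by
    have pos : ∀ x : ℝ, 0 < x → |Real.sinc x - 1| ≤ x ^ 2 := by
      intro x hx
      have h1 := Real.sin_gt_sub_cube hx
      have h2 := Real.sinc_le_one x
      rw [abs_of_nonpos (by linarith), Real.sinc_of_ne_zero hx.ne']
      have h3 : 1 - x ^ 2 ≤ Real.sin x / x := by
        rw [le_div_iff₀ hx]
        nlinarith [pow_pos hx 3]
      linarith
    intro x
    rcases lt_trichotomy x 0 with h | h | h
    · simpa [Real.sinc_neg] using pos (-x) (by linarith)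
    · simp [h]
    · exact pos x h
  have hs : Summable fun p : Nat.Primes => Real.sinc (Real.pi / (p : ℕ)) - 1 := by
    have h2 : Summable fun p : Nat.Primes => (Real.pi / ((p : ℕ) : ℝ)) ^ 2 := by
      have h3 : Summable fun n : ℕ => Real.pi ^ 2 * (1 / (n : ℝ) ^ 2) :=
        (Real.summable_one_div_nat_pow.2 one_lt_two).mul_left _
      refine (h3.subtype {p | p.Prime}).congr fun p => ?_
      change Real.pi ^ 2 * (1 / ((p.1 : ℕ) : ℝ) ^ 2) = (Real.pi / ((p.1 : ℕ) : ℝ)) ^ 2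
      rw [div_pow]; ring
    exact Summable.of_norm_bounded h2 fun p => bound _
  simpa using Real.multipliable_one_add_of_summable hs

end BooleanCube

end

/-!
The upper bound rests on a reproducing system. Suppose that a normed space `X` carries finitely many
vectors `b_j` and functionals `ψ_j` with `f = ∑ ψ_j(f) b_j`, and that
`‖∑ ε_j ψ_j(f) b_j‖ ≤ K ‖f‖` whenever `|ε_j| ≤ 1`. Then `gl(X) ≤ K`: an operator `a` factors through
`ℓ₁` by `v f = (ψ_j(f) ‖a b_j‖)_j` followed by `c ↦ ∑ c_j a b_j / ‖a b_j‖`, and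
`‖v‖ ≤ K π₁(a)` is the definition of `π₁` applied to the vectors `ψ_j(f) b_j`
(`glConst_le_of_frame`).

If `𝒮` consists of `d`-sets, such a system is obtained from the partial derivatives `D_i f`, which
lie in `B_{𝒮^♭}`. Its functionals are the values `D_i f(y)` at the points `y` of the cube. To go
back from a family `(g_i)` of arbitrary functions on the cube, apply to each `g_i` a projection `P`
of the space of all functions onto `B_{𝒮^♭}`, take the part of `∑ x_i (P g_i)(x)` without repeated
variables, apply `𝐐`, and divide by `d`. Three norms enter.

* `∑ |D_i f(y)| ≤ e d 2^{d/2} ‖f‖` (`sum_abs_pderiv_le`). For signs `x_i`, the sum `∑ x_i D_i f(y)`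
  is the derivative at `0` of the trigonometric polynomial `θ ↦ f(y cos θ + x sin θ)`, which has
  degree `d` and is bounded by `2^{d/2} ‖f‖` on the real line. The maximum principle bounds it by
  `e^{d |Im θ|} 2^{d/2} ‖f‖` in the complex plane, and Cauchy's estimate does the rest.
* Removing the repeated variables costs `2^d` (`abs_tetra_le`): average over all subsets `A` of
  `[N]`, feeding the coordinates in `A` to the outer variable and the others to the `P g_i`.
* `‖P‖` can be taken arbitrarily close to `λ(B_{𝒮^♭}, ℓ_∞(cube))`, which is at most `λ(B_{𝒮^♭})`.

Together they give the constant `e (2√2)^d ‖𝐐‖ ‖P‖`. It is at most the asserted one because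
`κ² ≥ 3`, which already follows from the factors of the product at the primes `2` and `3`.

For families of sets of size at most `d`, the systems of the single levels are put together.
The projection onto a level has norm at most `(1 + √2)^d`: the polynomial `w ↦ f(w x)` is bounded
by `(1 + √2)^d ‖f‖` on the complex unit circle, again by the estimate for trigonometric polynomials
with `w = sin θ`.
-/

open scoped ENNReal NNReal

namespace BooleanCube

/-! ### Unconditional reproducing systems and the Gordon–Lewis constant -/

/-- `X` has a finite reproducing system with unconditional constant at most `K`. The system is
encoded by its analysis operator `A f = (ψ_j(f))_j` and its synthesis operator
`B c = ∑ c_j b_j`. -/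
def HasUncondFrame (X : Type) [NormedAddCommGroup X] [NormedSpace ℝ X] (K : ℝ) : Prop :=
  ∃ (ι : Type) (_ : Fintype ι) (A : X →ₗ[ℝ] (ι → ℝ)) (B : (ι → ℝ) →ₗ[ℝ] X),
    (∀ f, B (A f) = f) ∧ ∀ f (ε : ι → ℝ), (∀ j, |ε j| ≤ 1) → ‖B (ε * A f)‖ ≤ K * ‖f‖

section Frame

variable {X : Type} [NormedAddCommGroup X] [NormedSpace ℝ X]

/-- The `ℓ₁` norm, as the norm of `L₁` of the counting measure. -/
theorem norm_lp_one_count {ι : Type} [Fintype ι] [MeasurableSpace ι]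
    [MeasurableSingletonClass ι] (g : MeasureTheory.Lp ℝ 1 (MeasureTheory.Measure.count (α := ι))) :
    ‖g‖ = ∑ j, |g j| := by
  rw [MeasureTheory.L1.norm_eq_integral_norm, MeasureTheory.integral_count]
  rfl

theorem abs_sign_le_one (r : ℝ) : |(SignType.sign r : ℝ)| ≤ 1 := by
  rcases SignType.trichotomy (SignType.sign r) with h | h | h <;> rw [h] <;> simp

/-- The family `(ψ_j(f) b_j)_j` has weak `ℓ₁` norm at most `K ‖f‖`. -/
theorem sum_abs_functional_le {ι : Type} [Fintype ι] {A : X →ₗ[ℝ] (ι → ℝ)}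
    {B : (ι → ℝ) →ₗ[ℝ] X} {K : ℝ}
    (hK : ∀ f (ε : ι → ℝ), (∀ j, |ε j| ≤ 1) → ‖B (ε * A f)‖ ≤ K * ‖f‖)
    (f : X) (φ : StrongDual ℝ X) (hφ : ‖φ‖ ≤ 1) [DecidableEq ι] :
    ∑ j, |φ (A f j • B (Pi.single j 1))| ≤ K * ‖f‖ := by
  set ε : ι → ℝ := fun j => SignType.sign (φ (A f j • B (Pi.single j 1)))
  have h1 : ∑ j, |φ (A f j • B (Pi.single j 1))| = φ (B (ε * A f)) := by
    conv_rhs => rw [pi_eq_sum_univ' (ε * A f)]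
    rw [map_sum, map_sum]
    refine Finset.sum_congr rfl fun j _ => ?_
    rw [map_smul B, Pi.mul_apply, mul_smul, map_smul φ (ε j)]
    exact (sign_mul_self _).symm
  rw [h1]
  have hεb : ∀ j, |ε j| ≤ 1 := fun j => abs_sign_le_one _
  calc φ (B (ε * A f)) ≤ ‖φ (B (ε * A f))‖ := Real.le_norm_self _
    _ ≤ ‖φ‖ * ‖B (ε * A f)‖ := φ.le_opNorm _
    _ ≤ 1 * ‖B (ε * A f)‖ := by gcongr
    _ ≤ K * ‖f‖ := by rw [one_mul]; exact hK f ε hεb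

/-- An operator on a space with an unconditional reproducing system factors through `ℓ₁`, realized
as `L₁` of the counting measure on the index set. -/
theorem gammaOne_le_of_frame {Y : Type} [NormedAddCommGroup Y] [NormedSpace ℝ Y]
    {K : ℝ} (hK0 : 0 ≤ K) (h : HasUncondFrame X K) (a : X →L[ℝ] Y)
    (C : ℝ≥0) (hC : IsOneSummingWith C a) :
    gammaOne a ≤ ENNReal.ofReal K * C := by
  classical
  obtain ⟨ι, _, A, B, hAB, hK⟩ := h
  let _ : MeasurableSpace ι := ⊤
  have : MeasurableSingletonClass ι := ⟨fun _ => trivial⟩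
  set b : ι → Y := fun j => a (B (Pi.single j 1)) with hb
  have hmem : ∀ g : ι → ℝ, MeasureTheory.MemLp g 1 (MeasureTheory.Measure.count (α := ι)) :=
    fun g => MeasureTheory.MemLp.of_discrete
  have hcoe : ∀ g : ι → ℝ, ⇑((hmem g).toLp g) = g := fun g =>
    funext (MeasureTheory.Measure.ae_count_iff.1 (hmem g).coeFn_toLp)
  -- `v f = (A f j * ‖b j‖)_j`, a bounded operator because `a` is `1`-summing.
  let v₀ : X →ₗ[ℝ] MeasureTheory.Lp ℝ 1 (MeasureTheory.Measure.count (α := ι)) :=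
    { toFun := fun f => (hmem fun j => A f j * ‖b j‖).toLp _
      map_add' := fun f g => by
        rw [← MeasureTheory.MemLp.toLp_add]
        congr 1
        ext j
        simp [add_mul]
      map_smul' := fun c f => by
        rw [RingHom.id_apply, ← MeasureTheory.MemLp.toLp_const_smul]
        congr 1
        ext j
        simp [mul_assoc] }
  have hv₀ : ∀ f, ⇑(v₀ f) = fun j => A f j * ‖b j‖ := fun f => hcoe _
  have hvb : ∀ f, ‖v₀ f‖ ≤ (C * K) * ‖f‖ := by
    intro f
    rw [norm_lp_one_count, hv₀]
    have hs := hC (Fintype.card ι) fun m =>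
      A f ((Fintype.equivFin ι).symm m) • B (Pi.single ((Fintype.equivFin ι).symm m) 1)
    have h1 : (⨆ (φ : StrongDual ℝ X) (_ : ‖φ‖ ≤ 1), ∑ m, ‖φ (A f ((Fintype.equivFin ι).symm m) •
        B (Pi.single ((Fintype.equivFin ι).symm m) 1))‖ₑ) ≤ ENNReal.ofReal (K * ‖f‖) := by
      refine iSup₂_le fun φ hφ => ?_
      rw [(Fintype.equivFin ι).symm.sum_comp fun j => ‖φ (A f j • B (Pi.single j 1))‖ₑ]
      simp only [Real.enorm_eq_ofReal_abs]
      rw [← ENNReal.ofReal_sum_of_nonneg fun _ _ => abs_nonneg _]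
      exact ENNReal.ofReal_le_ofReal (sum_abs_functional_le hK f φ hφ)
    have h2 : ENNReal.ofReal (∑ j, |A f j * ‖b j‖|) ≤ ENNReal.ofReal (C * (K * ‖f‖)) := by
      refine le_trans (le_of_eq ?_) (hs.trans ((mul_le_mul_right h1 (C : ℝ≥0∞)).trans (le_of_eq ?_)))
      · rw [(Fintype.equivFin ι).symm.sum_comp fun j => ‖a (A f j • B (Pi.single j 1))‖ₑ,
          ENNReal.ofReal_sum_of_nonneg fun _ _ => abs_nonneg _]
        refine Finset.sum_congr rfl fun j _ => ?_
        rw [map_smul, ← ofReal_norm, norm_smul, abs_mul, abs_norm, Real.norm_eq_abs]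
      · rw [ENNReal.ofReal_mul C.coe_nonneg, ENNReal.ofReal_coe_nnreal]
    have h3 := (ENNReal.ofReal_le_ofReal_iff (by positivity)).1 h2
    linarith
  let v := v₀.mkContinuous (C * K) hvb
  -- `w g = ∑ g j • (b j / ‖b j‖)`; indices with `b j = 0` contribute nothing.
  let w₀ : MeasureTheory.Lp ℝ 1 (MeasureTheory.Measure.count (α := ι)) →ₗ[ℝ] Y :=
    { toFun := fun g => ∑ j, g j • (‖b j‖⁻¹ • b j)
      map_add' := fun f g => by
        have := funext (MeasureTheory.Measure.ae_count_iff.1 (MeasureTheory.Lp.coeFn_add f g))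
        rw [this, ← Finset.sum_add_distrib]
        simp [add_smul]
      map_smul' := fun c g => by
        have := funext (MeasureTheory.Measure.ae_count_iff.1 (MeasureTheory.Lp.coeFn_smul c g))
        rw [this, Finset.smul_sum]
        simp [mul_smul] }
  have hwb : ∀ g, ‖w₀ g‖ ≤ 1 * ‖g‖ := by
    intro g
    rw [one_mul, norm_lp_one_count]
    refine (norm_sum_le _ _).trans (Finset.sum_le_sum fun j _ => ?_)
    rw [norm_smul, norm_smul, norm_inv, norm_norm, Real.norm_eq_abs]
    have : ‖b j‖⁻¹ * ‖b j‖ ≤ 1 := inv_mul_le_one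
    nlinarith [abs_nonneg (g j)]
  let w₁ := w₀.mkContinuous 1 hwb
  let w := (NormedSpace.inclusionInDoubleDual ℝ Y).comp w₁
  have hw1 : ‖w‖ ≤ 1 := by
    refine (ContinuousLinearMap.opNorm_comp_le _ _).trans ?_
    have h1 := NormedSpace.inclusionInDoubleDual_norm_le ℝ Y
    have h2 : ‖w₁‖ ≤ 1 := LinearMap.mkContinuous_norm_le _ zero_le_one _
    exact mul_le_one₀ h1 (norm_nonneg _) h2
  have hv1 : ‖v‖ ≤ C * K := LinearMap.mkContinuous_norm_le _ (by positivity) _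
  have hfac : w.comp v = (NormedSpace.inclusionInDoubleDual ℝ Y).comp a := by
    have : w₁.comp v = a := by
      ext f
      change ∑ j, (v₀ f) j • (‖b j‖⁻¹ • b j) = a f
      rw [hv₀]
      conv_rhs => rw [← hAB f, pi_eq_sum_univ' (A f), map_sum, map_sum]
      refine Finset.sum_congr rfl fun j _ => ?_
      rw [map_smul, map_smul]
      change _ = A f j • b j
      rw [smul_smul]
      by_cases h0 : b j = 0
      · simp [h0]
      · rw [mul_assoc, mul_inv_cancel₀ (norm_ne_zero_iff.2 h0), mul_one]
    rw [ContinuousLinearMap.comp_assoc, this]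
  refine (iInf_le _ ι).trans <| (iInf_le _ ⊤).trans <| (iInf_le _ MeasureTheory.Measure.count).trans <|
    (iInf_le _ v).trans <| (iInf_le _ w).trans <| (iInf_le _ hfac).trans ?_
  rw [← ofReal_norm, ← ofReal_norm, ← ENNReal.ofReal_mul (norm_nonneg _),
    ← ENNReal.ofReal_coe_nnreal, ← ENNReal.ofReal_mul hK0]
  refine ENNReal.ofReal_le_ofReal ?_
  nlinarith [norm_nonneg v, norm_nonneg w]

theorem glConst_le_of_frame {K : ℝ} (hK0 : 0 ≤ K) (h : HasUncondFrame X K) :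
    glConst X ≤ ENNReal.ofReal K := by
  refine iInf₂_le_of_le K.toNNReal (fun a ha => ?_) le_rfl
  rw [piOne, iInf_subtype']
  have : Nonempty {C : ℝ≥0 // IsOneSummingWith C a} := ⟨⟨ha.choose, ha.choose_spec⟩⟩
  rw [ENNReal.mul_iInf (by simp)]
  exact le_iInf fun C => gammaOne_le_of_frame hK0 h a C.1 C.2

theorem HasUncondFrame.mono {K K' : ℝ} (h : HasUncondFrame X K) (hK : K ≤ K') :
    HasUncondFrame X K' := by
  obtain ⟨ι, i, A, B, h1, h2⟩ := h
  exact ⟨ι, i, A, B, h1, fun f ε hε =>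
    (h2 f ε hε).trans (mul_le_mul_of_nonneg_right hK (norm_nonneg f))⟩

/-- Reproducing systems of the summands of a decomposition `f = ∑ J_k R_k f` combine to one
of the whole space. -/
theorem HasUncondFrame.of_sum {n : ℕ} {Z : Fin n → Type} [∀ k, NormedAddCommGroup (Z k)]
    [∀ k, NormedSpace ℝ (Z k)] (R : ∀ k, X →ₗ[ℝ] Z k) (J : ∀ k, Z k →ₗ[ℝ] X)
    (hsum : ∀ f, ∑ k, J k (R k f) = f) {c : ℝ} (hR : ∀ k f, ‖R k f‖ ≤ c * ‖f‖)
    (hJ : ∀ k z, ‖J k z‖ ≤ ‖z‖) {K : Fin n → ℝ} (hK0 : ∀ k, 0 ≤ K k)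
    (h : ∀ k, HasUncondFrame (Z k) (K k)) :
    HasUncondFrame X (c * ∑ k, K k) := by
  choose ι i A B hAB hK using h
  let S : ∀ k, ((Σ k, ι k) → ℝ) →ₗ[ℝ] (ι k → ℝ) := fun k =>
    LinearMap.funLeft ℝ ℝ (Sigma.mk k)
  refine ⟨Σ k, ι k, inferInstance, LinearMap.pi fun p => LinearMap.proj p.2 ∘ₗ A p.1 ∘ₗ R p.1,
    ∑ k, J k ∘ₗ B k ∘ₗ S k, fun f => ?_, fun f ε hε => ?_⟩
  · rw [LinearMap.sum_apply]
    conv_rhs => rw [← hsum f]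
    refine Finset.sum_congr rfl fun k _ => ?_
    conv_rhs => rw [← hAB k (R k f)]
    rfl
  · rw [LinearMap.sum_apply, Finset.mul_sum, Finset.sum_mul]
    refine (norm_sum_le _ _).trans (Finset.sum_le_sum fun k _ => (hJ k _).trans ?_)
    refine (hK k (R k f) (fun j => ε ⟨k, j⟩) fun j => hε _).trans ?_
    nlinarith [hR k f, hK0 k]

end Frame

/-! ### Multi-affine extensions and partial derivatives -/

section Extension

variable {N : ℕ}

theorem abs_coord_le_one (x : Cube N) (k : Fin N) : |((x k : ℤ) : ℝ)| ≤ 1 := by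
  rcases Int.units_eq_one_or (x k) with h | h <;> simp [h]

theorem abs_walsh (S : Finset (Fin N)) (x : Cube N) : |walsh S x| = 1 := by
  rw [walsh, Finset.abs_prod]
  refine Finset.prod_eq_one fun k _ => ?_
  rcases Int.units_eq_one_or (x k) with h | h <;> simp [h]

theorem walsh_insert {T : Finset (Fin N)} {i : Fin N} (hi : i ∉ T) (x : Cube N) :
    walsh (insert i T) x = ((x i : ℤ) : ℝ) * walsh T x :=
  Finset.prod_insert hi

/-- The multi-affine extension `v ↦ ∑ f̂(S) ∏_{k ∈ S} v_k` of a function on the cube to `ℝ^N`. -/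
noncomputable def affineExt (f : Cube N → ℝ) (v : Fin N → ℝ) : ℝ := ∑ S, fourierCoeff S f * ∏ k ∈ S, v k

/-- The value at `v` is the mean of `f` for the product measure on the cube with barycenter `v`
(a signed measure unless `v ∈ [-1, 1]^N`). -/
theorem affineExt_eq_sum_weights (f : Cube N → ℝ) (v : Fin N → ℝ) :
    affineExt f v = ∑ x, f x * ∏ k, ((1 + v k * ((x k : ℤ) : ℝ)) / 2) := by
  have h : ∀ x : Cube N, ∏ k, ((1 + v k * ((x k : ℤ) : ℝ)) / 2) =
      (1 / 2 ^ N : ℝ) * ∑ S, walsh S x * ∏ k ∈ S, v k := by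
    intro x
    rw [Finset.prod_div_distrib, Finset.prod_one_add, Finset.powerset_univ]
    simp only [Finset.prod_mul_distrib, Finset.prod_const, Finset.card_univ, Fintype.card_fin]
    rw [div_eq_mul_inv, mul_comm, one_div]
    refine congrArg _ (Finset.sum_congr rfl fun S _ => ?_)
    rw [mul_comm, walsh]
  simp only [h, affineExt]
  have : ∀ S : Finset (Fin N), fourierCoeff S f = (1 / 2 ^ N : ℝ) * ∑ x, f x * walsh S x :=
    fun _ => rfl
  simp only [this, Finset.mul_sum, Finset.sum_mul]
  rw [Finset.sum_comm]
  refine Finset.sum_congr rfl fun x _ => Finset.sum_congr rfl fun S _ => ?_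
  ring

theorem sum_weights (v : Fin N → ℝ) :
    ∑ x : Cube N, ∏ k, ((1 + v k * ((x k : ℤ) : ℝ)) / 2) = 1 := by
  refine (Finset.sum_congr Fintype.piFinset_univ.symm fun _ _ => rfl).trans ?_
  rw [← Finset.prod_univ_sum (fun _ => Finset.univ)
    (fun k (e : ℤˣ) => (1 + v k * ((e : ℤ) : ℝ)) / 2)]
  refine Finset.prod_eq_one fun k _ => ?_
  rw [show (Finset.univ : Finset ℤˣ) = {1, -1} from rfl, Finset.sum_pair (by decide)]
  push_cast
  ring

theorem abs_affineExt_le (f : Cube N → ℝ) {v : Fin N → ℝ} (hv : ∀ k, |v k| ≤ 1) :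
    |affineExt f v| ≤ ‖f‖ := by
  rw [affineExt_eq_sum_weights]
  have hw : ∀ x : Cube N, 0 ≤ ∏ k, ((1 + v k * ((x k : ℤ) : ℝ)) / 2) := by
    refine fun x => Finset.prod_nonneg fun k _ => ?_
    have := abs_le.1 (hv k)
    rcases Int.units_eq_one_or (x k) with h | h <;> rw [h] <;> push_cast <;> linarith
  calc |∑ x : Cube N, f x * ∏ k, ((1 + v k * ((x k : ℤ) : ℝ)) / 2)|
      ≤ ∑ x : Cube N, ‖f‖ * ∏ k, ((1 + v k * ((x k : ℤ) : ℝ)) / 2) := by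
        refine (Finset.abs_sum_le_sum_abs _ _).trans (Finset.sum_le_sum fun x _ => ?_)
        rw [abs_mul, abs_of_nonneg (hw x)]
        exact mul_le_mul_of_nonneg_right (norm_le_pi_norm f x) (hw x)
    _ = ‖f‖ := by rw [← Finset.mul_sum, sum_weights, mul_one]

/-- Fourier inversion: the multi-affine extension restricts to `f` on the cube, since the product
measure with barycenter `y` in the cube is the point mass at `y`. -/
theorem sum_fourierCoeff_mul_walsh (f : Cube N → ℝ) (y : Cube N) :
    ∑ S, fourierCoeff S f * walsh S y = f y := by
  change affineExt f (fun k => ((y k : ℤ) : ℝ)) = f y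
  rw [affineExt_eq_sum_weights, Finset.sum_eq_single (a := y)]
  · rw [Finset.prod_eq_one fun k _ => ?_, mul_one]
    rcases Int.units_eq_one_or (y k) with h | h <;> simp [h]
  · intro x _ hx
    obtain ⟨k, hk⟩ := Function.ne_iff.1 hx
    rw [Finset.prod_eq_zero (Finset.mem_univ k), mul_zero]
    rcases Int.units_eq_one_or (x k) with h | h <;> rcases Int.units_eq_one_or (y k) with h' | h' <;>
      simp_all
  · simp

/-- A sum over all frequencies reduces to a sum over the spectrum. -/
theorem sum_eq_of_mem {𝒮 : Finset (Finset (Fin N))} {f : Cube N → ℝ} (hf : f ∈ walshSpace 𝒮)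
    {R : Type*} [AddCommMonoid R] (F : ℝ → Finset (Fin N) → R) (hF : ∀ S, F 0 S = 0) :
    ∑ S, F (fourierCoeff S f) S = ∑ S ∈ 𝒮, F (fourierCoeff S f) S := by
  refine (Finset.sum_subset (Finset.subset_univ _) fun S _ hS => ?_).symm
  rw [hf S hS, hF]

theorem coeffProj_apply (𝒜 𝒮 : Finset (Finset (Fin N))) (f : walshSpace 𝒜) :
    (coeffProj 𝒜 𝒮 f : Cube N → ℝ) = ∑ S ∈ 𝒮, fourierCoeff S (f : Cube N → ℝ) • walsh S := by
  change (∑ S ∈ 𝒮, (fourierCoeff S).smulRight (walsh S)) (f : Cube N → ℝ) = _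
  simp

theorem sum_smul_walsh_of_mem {𝒮 : Finset (Finset (Fin N))} {f : Cube N → ℝ}
    (hf : f ∈ walshSpace 𝒮) : ∑ S ∈ 𝒮, fourierCoeff S f • walsh S = f := by
  ext y
  rw [← sum_fourierCoeff_mul_walsh f y, sum_eq_of_mem hf (fun c S => c * walsh S y) (by simp)]
  simp

theorem walsh_mem {𝒮 : Finset (Finset (Fin N))} {S : Finset (Fin N)} (hS : S ∈ 𝒮) :
    walsh S ∈ walshSpace 𝒮 := by
  intro T hT
  rw [fourierCoeff_walsh, if_neg (fun h : S = T => hT (h ▸ hS))]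

theorem norm_walsh (S : Finset (Fin N)) : ‖walsh S‖ = 1 := by
  refine le_antisymm ((pi_norm_le_iff_of_nonneg zero_le_one).2 fun x => (abs_walsh S x).le) ?_
  exact (abs_walsh S 1).symm.le.trans (norm_le_pi_norm (walsh S) 1)

theorem coeffProj_apply_of_mem {𝒜 𝒮 : Finset (Finset (Fin N))} (f : walshSpace 𝒜)
    (hf : (f : Cube N → ℝ) ∈ walshSpace 𝒮) : (coeffProj 𝒜 𝒮 f : Cube N → ℝ) = f := by
  rw [coeffProj_apply, sum_smul_walsh_of_mem hf]

theorem walshSpace_mono {𝒮 𝒯 : Finset (Finset (Fin N))} (h : 𝒮 ⊆ 𝒯) :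
    walshSpace 𝒮 ≤ walshSpace 𝒯 :=
  fun _ hf T hT => hf T fun hS => hT (h hS)

/-- The partial derivative `D_i f = ∑_{S ∋ i} f̂(S) χ_{S \ {i}}`. -/
noncomputable def pderiv (i : Fin N) : (Cube N → ℝ) →ₗ[ℝ] (Cube N → ℝ) :=
  ∑ S with i ∈ S, (fourierCoeff S).smulRight (walsh (S \ {i}))

theorem pderiv_apply (i : Fin N) (f : Cube N → ℝ) :
    pderiv i f = ∑ S with i ∈ S, fourierCoeff S f • walsh (S \ {i}) := by
  simp [pderiv]

theorem pderiv_mem_flat {𝒮 : Finset (Finset (Fin N))} {f : Cube N → ℝ} (hf : f ∈ walshSpace 𝒮)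
    (i : Fin N) : pderiv i f ∈ walshSpace (flat 𝒮) := by
  rw [pderiv_apply]
  refine Submodule.sum_mem _ fun S hS => ?_
  by_cases h : S ∈ 𝒮
  · refine Submodule.smul_mem _ _ (walsh_mem ?_)
    exact Finset.mem_biUnion.2 ⟨S, h, Finset.mem_image_of_mem _ (Finset.mem_filter.1 hS).2⟩
  · rw [hf S h, zero_smul]
    exact Submodule.zero_mem _

theorem fourierCoeff_pderiv (i : Fin N) (f : Cube N → ℝ) {T : Finset (Fin N)} (hT : i ∉ T) :
    fourierCoeff T (pderiv i f) = fourierCoeff (insert i T) f := by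
  rw [pderiv_apply]
  simp only [map_sum, map_smul, fourierCoeff_walsh, smul_eq_mul, mul_ite, mul_one, mul_zero]
  rw [Finset.sum_eq_single (insert i T)]
  · rw [if_pos]
    rw [Finset.insert_sdiff_of_mem _ (Finset.mem_singleton_self i)]
    simpa using hT
  · intro S hS hne
    rw [if_neg]
    rintro rfl
    refine hne ?_
    rw [Finset.sdiff_singleton_eq_erase, Finset.insert_erase (Finset.mem_filter.1 hS).2]
  · intro h; simp at h

theorem card_of_mem_flat {𝒮 : Finset (Finset (Fin N))} {d : ℕ} (h : ∀ S ∈ 𝒮, S.card = d)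
    {T : Finset (Fin N)} (hT : T ∈ flat 𝒮) : T.card + 1 = d := by
  simp only [flat, Finset.mem_biUnion, Finset.mem_image] at hT
  obtain ⟨S, hS, i, hi, rfl⟩ := hT
  rw [Finset.sdiff_singleton_eq_erase, Finset.card_erase_add_one hi, h S hS]

end Extension

/-! ### Trigonometric polynomials: derivatives and homogeneous parts -/

section Complexification

variable {N : ℕ}

/-- The multi-affine extension of a function on the cube to `ℂ^N`. -/
noncomputable def complexExt (f : Cube N → ℝ) (z : Fin N → ℂ) : ℂ :=
  ∑ S, (fourierCoeff S f : ℂ) * ∏ k ∈ S, z k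

theorem complexExt_ofReal (f : Cube N → ℝ) (v : Fin N → ℝ) :
    complexExt f (fun k => (v k : ℂ)) = (affineExt f v : ℂ) := by
  simp [complexExt, affineExt]

/-- The upper half-plane case of `norm_complexExt_trig_le`. There `z = e^{iθ}` lies in the unit disc,
and `z^d` times the function is a polynomial in `z`, to which the maximum principle applies. -/
theorem norm_complexExt_trig_le_of_nonneg {f : Cube N → ℝ} {d : ℕ}
    (hf : ∀ S : Finset (Fin N), d < S.card → fourierCoeff S f = 0) (x y : Fin N → ℝ) {M : ℝ}
    (hM : ∀ t : ℝ, |affineExt f (fun k => y k * Real.cos t + x k * Real.sin t)| ≤ M)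
    {θ : ℂ} (hθ : 0 ≤ θ.im) :
    ‖complexExt f (fun k => y k * Complex.cos θ + x k * Complex.sin θ)‖ ≤
      Real.exp (d * θ.im) * M := by
  set G : ℂ → ℂ := fun z => ∑ S, (fourierCoeff S f : ℂ) * (z ^ (d - S.card) *
    ∏ k ∈ S, (y k * ((z ^ 2 + 1) / 2) + x k * ((1 - z ^ 2) * Complex.I / 2))) with hG
  have hGF : ∀ θ : ℂ, G (Complex.exp (θ * Complex.I)) = Complex.exp (θ * Complex.I) ^ d *
      complexExt f (fun k => y k * Complex.cos θ + x k * Complex.sin θ) := by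
    intro θ
    set z := Complex.exp (θ * Complex.I) with hz
    have hinv : z * Complex.exp (-θ * Complex.I) = 1 := by
      rw [hz, ← Complex.exp_add]; simp
    have hfac : ∀ k, y k * ((z ^ 2 + 1) / 2) + x k * ((1 - z ^ 2) * Complex.I / 2) =
        z * (y k * Complex.cos θ + x k * Complex.sin θ) := by
      intro k
      rw [Complex.cos, Complex.sin, ← hz]
      linear_combination (-(y k : ℂ) / 2 - x k * Complex.I / 2) * hinv
    simp only [hG, complexExt, Finset.mul_sum, hfac]
    refine Finset.sum_congr rfl fun S _ => ?_
    by_cases hS : d < S.card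
    · simp [hf S hS]
    · rw [Finset.prod_mul_distrib, Finset.prod_const]
      have : z ^ d = z ^ (d - S.card) * z ^ S.card := by
        rw [← pow_add, Nat.sub_add_cancel (not_lt.1 hS)]
      rw [this]
      ring
  have hGd : Differentiable ℂ G := by
    rw [hG]
    fun_prop
  have hfr : ∀ z ∈ frontier (Metric.ball (0 : ℂ) 1), ‖G z‖ ≤ M := by
    intro z hz
    rw [frontier_ball _ one_ne_zero, mem_sphere_zero_iff_norm] at hz
    have hz' : z = Complex.exp ((z.arg : ℂ) * Complex.I) := by
      conv_lhs => rw [← Complex.norm_mul_exp_arg_mul_I z, hz]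
      simp
    rw [hz', hGF, norm_mul, norm_pow, Complex.norm_exp_ofReal_mul_I, one_pow, one_mul]
    have := hM z.arg
    rw [← Real.norm_eq_abs, ← Complex.norm_real, ← complexExt_ofReal] at this
    simpa using this
  have hzn : ‖Complex.exp (θ * Complex.I)‖ = Real.exp (-θ.im) := by
    rw [Complex.norm_exp]; simp
  have hGb : ‖G (Complex.exp (θ * Complex.I))‖ ≤ M := by
    refine Complex.norm_le_of_forall_mem_frontier_norm_le Metric.isBounded_ball
      hGd.diffContOnCl hfr ?_
    rw [closure_ball _ one_ne_zero, mem_closedBall_zero_iff, hzn]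
    simpa using hθ
  rw [hGF, norm_mul, norm_pow, hzn, ← Real.exp_nat_mul, mul_neg, Real.exp_neg] at hGb
  rwa [inv_mul_le_iff₀ (Real.exp_pos _)] at hGb

/-- A trigonometric polynomial of degree at most `d` bounded by `M` on the real line is bounded by
`M e^{d |Im θ|}` in the plane; stated for `θ ↦ f(y cos θ + x sin θ)`. -/
theorem norm_complexExt_trig_le {f : Cube N → ℝ} {d : ℕ}
    (hf : ∀ S : Finset (Fin N), d < S.card → fourierCoeff S f = 0) (x y : Fin N → ℝ) {M : ℝ}
    (hM : ∀ t : ℝ, |affineExt f (fun k => y k * Real.cos t + x k * Real.sin t)| ≤ M) (θ : ℂ) :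
    ‖complexExt f (fun k => y k * Complex.cos θ + x k * Complex.sin θ)‖ ≤
      Real.exp (d * |θ.im|) * M := by
  rcases le_total 0 θ.im with h | h
  · rw [abs_of_nonneg h]
    exact norm_complexExt_trig_le_of_nonneg hf x y hM h
  · rw [abs_of_nonpos h]
    have := norm_complexExt_trig_le_of_nonneg hf (-x) y (M := M) (fun t => ?_) (θ := -θ)
      (by simpa using h)
    · simpa using this
    · simpa using hM (-t)

theorem affineExt_smul {f : Cube N → ℝ} {d : ℕ} (hf : f ∈ walshSpace (homog N d)) (c : ℝ)
    (v : Fin N → ℝ) : affineExt f (fun k => c * v k) = c ^ d * affineExt f v := by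
  simp only [affineExt, Finset.mul_sum]
  refine Finset.sum_congr rfl fun S _ => ?_
  by_cases hS : S ∈ homog N d
  · rw [Finset.prod_mul_distrib, Finset.prod_const, (Finset.mem_powersetCard.1 hS).2]
    ring
  · simp [hf S hS]

theorem abs_cos_add_sin_le {a b : ℝ} (ha : |a| ≤ 1) (hb : |b| ≤ 1) (t : ℝ) :
    |a * Real.cos t + b * Real.sin t| ≤ √2 := by
  refine Real.abs_le_sqrt ?_
  have h1 := Real.sin_sq_add_cos_sq t
  have h2 := sq_le_one_iff_abs_le_one a |>.2 ha
  have h3 := sq_le_one_iff_abs_le_one b |>.2 hb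
  nlinarith [sq_nonneg (a * Real.sin t - b * Real.cos t)]

/-- The derivative of `θ ↦ f(y cos θ + x sin θ)` at `0` is the derivative of `f` at `y` in
direction `x`. -/
theorem hasDerivAt_complexExt_trig (f : Cube N → ℝ) (x : Fin N → ℝ) (y : Cube N) :
    HasDerivAt (fun θ : ℂ => complexExt f
      (fun k => ((y k : ℤ) : ℝ) * Complex.cos θ + x k * Complex.sin θ))
      ((∑ i, x i * pderiv i f y : ℝ) : ℂ) 0 := by
  have h1 : ∀ k, HasDerivAt (fun θ : ℂ => (((y k : ℤ) : ℝ) : ℂ) * Complex.cos θ +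
      x k * Complex.sin θ) (x k : ℂ) 0 := by
    intro k
    refine (((Complex.hasDerivAt_cos 0).const_mul _).fun_add
      ((Complex.hasDerivAt_sin 0).const_mul (x k : ℂ))).congr_deriv ?_
    simp
  have h2 : HasDerivAt (fun θ : ℂ => complexExt f
      (fun k => ((y k : ℤ) : ℝ) * Complex.cos θ + x k * Complex.sin θ)) _ 0 :=
    HasDerivAt.fun_sum fun S _ => (HasDerivAt.fun_finsetProd fun k (_ : k ∈ S) => h1 k).const_mul
      (fourierCoeff S f : ℂ)
  refine h2.congr_deriv ?_
  simp only [Complex.cos_zero, Complex.sin_zero, mul_one, mul_zero, add_zero, smul_eq_mul]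
  simp only [pderiv_apply, Finset.sum_apply, Pi.smul_apply, smul_eq_mul, Finset.mul_sum]
  have : ∀ i : Fin N, ∑ S with i ∈ S, x i * (fourierCoeff S f * walsh (S \ {i}) y) =
      ∑ S, if i ∈ S then x i * (fourierCoeff S f * walsh (S \ {i}) y) else 0 :=
    fun i => Finset.sum_filter _ _
  simp only [this]
  rw [Finset.sum_comm]
  simp only [Finset.sum_ite_mem, Finset.univ_inter, walsh, Finset.sdiff_singleton_eq_erase]
  push_cast
  refine Finset.sum_congr rfl fun S _ => Finset.sum_congr rfl fun i _ => ?_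
  ring

/-- A Bernstein inequality for `d`-homogeneous functions on the cube. -/
theorem sum_abs_pderiv_le {f : Cube N → ℝ} {d : ℕ} (hd : 1 ≤ d)
    (hf : f ∈ walshSpace (homog N d)) (y : Cube N) :
    ∑ i, |pderiv i f y| ≤ Real.exp 1 * d * √2 ^ d * ‖f‖ := by
  set x : Fin N → ℝ := fun i => SignType.sign (pderiv i f y)
  have hx1 : ∀ i, |x i| ≤ 1 := fun i => abs_sign_le_one _
  have hsum : ∑ i, |pderiv i f y| = ∑ i, x i * pderiv i f y :=
    Finset.sum_congr rfl fun i _ => (sign_mul_self _).symm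
  have hdeg : ∀ S : Finset (Fin N), d < S.card → fourierCoeff S f = 0 := fun S hS =>
    hf S fun h => by rw [(Finset.mem_powersetCard.1 h).2] at hS; exact lt_irrefl _ hS
  have h2 : (0 : ℝ) < √2 := by positivity
  have hM : ∀ t : ℝ, |affineExt f (fun k => ((y k : ℤ) : ℝ) * Real.cos t + x k * Real.sin t)| ≤
      √2 ^ d * ‖f‖ := by
    intro t
    -- Rescaling by `√2` moves the point back into `[-1, 1]^N`.
    have h : (fun k => ((y k : ℤ) : ℝ) * Real.cos t + x k * Real.sin t) = fun k =>
        √2 * ((((y k : ℤ) : ℝ) * Real.cos t + x k * Real.sin t) / √2) := by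
      ext k; field_simp
    rw [h, affineExt_smul hf, abs_mul, abs_of_pos (pow_pos h2 d)]
    refine mul_le_mul_of_nonneg_left (abs_affineExt_le f fun k => ?_) (pow_pos h2 d).le
    rw [abs_div, abs_of_pos h2, div_le_one h2]
    exact abs_cos_add_sin_le (abs_coord_le_one y k) (hx1 k) t
  have hd0 : (0 : ℝ) < d := by exact_mod_cast hd
  have hder := hasDerivAt_complexExt_trig f x y
  -- The radius `1 / d` balances the growth `e^{d |Im θ|}` against the factor `1 / radius`.
  have hcauchy := Complex.norm_deriv_le_of_forall_mem_sphere_norm_le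
    (f := fun θ : ℂ => complexExt f
      (fun k => ((y k : ℤ) : ℝ) * Complex.cos θ + x k * Complex.sin θ))
    (c := 0) (R := (d : ℝ)⁻¹) (C := Real.exp 1 * (√2 ^ d * ‖f‖)) (by positivity)
    (Differentiable.diffContOnCl (by unfold complexExt; fun_prop)) (fun θ hθ => ?_)
  · rw [hder.deriv, Complex.norm_real, ← hsum] at hcauchy
    refine (Real.le_norm_self _).trans (hcauchy.trans (le_of_eq ?_))
    field_simp
  · refine (norm_complexExt_trig_le hdeg x _ hM θ).trans ?_
    refine mul_le_mul_of_nonneg_right (Real.exp_le_exp.2 ?_) (by positivity)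
    have h3 := Complex.abs_im_le_norm θ
    rw [mem_sphere_zero_iff_norm.1 hθ] at h3
    calc d * |θ.im| ≤ d * (d : ℝ)⁻¹ := by gcongr
      _ = 1 := mul_inv_cancel₀ hd0.ne'

/-- Since `|sin θ| ≥ sinh |Im θ|`, the preimage of the unit circle under `sin` lies in the strip
`|Im θ| ≤ arsinh 1 = log (1 + √2)`. -/
theorem exp_abs_im_le_of_norm_sin_eq_one {θ : ℂ} (h : ‖Complex.sin θ‖ = 1) :
    Real.exp |θ.im| ≤ 1 + √2 := by
  have h1 : Real.sinh θ.im ^ 2 ≤ 1 := by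
    have h2 : Complex.normSq (Complex.sin θ) = 1 := by
      rw [Complex.normSq_eq_norm_sq, h, one_pow]
    rw [Complex.sin_eq, Complex.normSq_apply] at h2
    simp only [← Complex.ofReal_sin, ← Complex.ofReal_cos, ← Complex.ofReal_sinh,
      ← Complex.ofReal_cosh, Complex.add_re, Complex.add_im, Complex.mul_re, Complex.mul_im,
      Complex.ofReal_re, Complex.ofReal_im, Complex.I_re, Complex.I_im] at h2
    have h3 := Real.cosh_sq θ.im
    have h4 := Real.sin_sq_add_cos_sq θ.re
    nlinarith [sq_nonneg (Real.sin θ.re)]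
  have h2 : Real.sinh |θ.im| ^ 2 ≤ 1 := by
    rcases abs_choice θ.im with h | h <;> rw [h] <;> simpa using h1
  have h3 : Real.cosh |θ.im| ≤ √2 := by
    refine Real.le_sqrt_of_sq_le ?_
    rw [Real.cosh_sq]; linarith
  rw [← Real.cosh_add_sinh]
  nlinarith

/-- The `k`-homogeneous part of a function of degree at most `d` is bounded by `(1 + √2)^d ‖f‖`: its
value at `x` is the `k`-th coefficient of the polynomial `w ↦ f(w x)`. -/
theorem abs_sum_level_le {f : Cube N → ℝ} {d : ℕ}
    (hf : ∀ S : Finset (Fin N), d < S.card → fourierCoeff S f = 0) (k : ℕ) (x : Cube N) :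
    |∑ S with S.card = k, fourierCoeff S f * walsh S x| ≤ (1 + √2) ^ d * ‖f‖ := by
  set p : ℂ → ℂ := fun w => ∑ S : Finset (Fin N),
    (((fourierCoeff S f * walsh S x : ℝ) : ℂ)) * w ^ S.card with hp
  have hbound : ∀ w ∈ Metric.sphere (0 : ℂ) 1, ‖p w‖ ≤ (1 + √2) ^ d * ‖f‖ := by
    intro w hw
    obtain ⟨θ, rfl⟩ := Complex.sin_surjective w
    have h := norm_complexExt_trig_le hf (fun k => ((x k : ℤ) : ℝ)) 0 (M := ‖f‖)
      (fun t => abs_affineExt_le f fun k => ?_) θ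
    · have heq : p (Complex.sin θ) = complexExt f (fun k => ((0 : Fin N → ℝ) k : ℂ) *
          Complex.cos θ + (((x k : ℤ) : ℝ) : ℂ) * Complex.sin θ) := by
        simp only [hp, complexExt, Pi.zero_apply, Complex.ofReal_zero, zero_mul, zero_add,
          Finset.prod_mul_distrib, Finset.prod_const, walsh]
        push_cast
        exact Finset.sum_congr rfl fun S _ => by ring
      rw [heq]
      refine h.trans (mul_le_mul_of_nonneg_right ?_ (norm_nonneg f))
      rw [Real.exp_nat_mul]
      exact pow_le_pow_left₀ (Real.exp_pos _).le
        (exp_abs_im_le_of_norm_sin_eq_one (mem_sphere_zero_iff_norm.1 hw)) d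
    · rw [Pi.zero_apply, zero_mul, zero_add, abs_mul]
      exact mul_le_one₀ (abs_coord_le_one x k) (abs_nonneg _) (Real.abs_sin_le_one t)
  have hd := Complex.norm_iteratedDeriv_le_of_forall_mem_sphere_norm_le k one_pos
    (f := p) (c := 0) (Differentiable.diffContOnCl (by rw [hp]; fun_prop)) hbound
  have hder : iteratedDeriv k p 0 = (k.factorial : ℂ) *
      ((∑ S with S.card = k, fourierCoeff S f * walsh S x : ℝ) : ℂ) := by
    rw [hp, iteratedDeriv_fun_sum (fun S _ => by fun_prop)]
    simp only [iteratedDeriv_const_mul_field, iteratedDeriv_fun_pow_zero]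
    rw [Finset.sum_filter, Complex.ofReal_sum, Finset.mul_sum]
    refine Finset.sum_congr rfl fun S _ => ?_
    by_cases h : S.card = k
    · simp [h, mul_comm]
    · simp [h, Ne.symm h]
  rw [hder, norm_mul, Complex.norm_natCast, Complex.norm_real, one_pow, div_one,
    Real.norm_eq_abs] at hd
  exact le_of_mul_le_mul_left hd (by positivity)

end Complexification

/-! ### The part without repeated variables -/

section Tetrahedral

variable {N : ℕ}

/-- The tetrahedral part of `∑ x_i h_i(x)`, that is, the sum of its terms `x_i χ_T(x)` with
`i ∉ T`. On the cube the remaining terms collapse to `χ_{T \ {i}}`. -/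
noncomputable def tetra : (Fin N → Cube N → ℝ) →ₗ[ℝ] (Cube N → ℝ) :=
  ∑ i, ∑ T with i ∉ T, (fourierCoeff T).smulRight (walsh (insert i T)) ∘ₗ LinearMap.proj i

theorem tetra_apply (h : Fin N → Cube N → ℝ) :
    tetra h = ∑ i, ∑ T with i ∉ T, fourierCoeff T (h i) • walsh (insert i T) := by
  simp [tetra]

theorem tetra_mem {𝒯 : Finset (Finset (Fin N))} {d : ℕ} (h𝒯 : ∀ T ∈ 𝒯, T.card + 1 = d)
    {h : Fin N → Cube N → ℝ} (hh : ∀ i, h i ∈ walshSpace 𝒯) :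
    tetra h ∈ walshSpace (homog N d) := by
  rw [tetra_apply]
  refine Submodule.sum_mem _ fun i _ => Submodule.sum_mem _ fun T hT => ?_
  by_cases hT' : T ∈ 𝒯
  · refine Submodule.smul_mem _ _ (walsh_mem ?_)
    rw [Finset.mem_powersetCard, Finset.card_insert_of_notMem (Finset.mem_filter.1 hT).2]
    exact ⟨Finset.subset_univ _, h𝒯 T hT'⟩
  · rw [hh i T hT', zero_smul]
    exact Submodule.zero_mem _

/-- Euler's identity for `d`-homogeneous functions. -/
theorem tetra_pderiv {d : ℕ} {f : Cube N → ℝ} (hf : f ∈ walshSpace (homog N d)) :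
    tetra (fun i => pderiv i f) = (d : ℝ) • f := by
  rw [tetra_apply]
  have h1 : ∀ i : Fin N, ∑ T with i ∉ T, fourierCoeff T (pderiv i f) • walsh (insert i T) =
      ∑ S, if i ∈ S then fourierCoeff S f • walsh S else 0 := by
    intro i
    rw [← Finset.sum_filter]
    refine Finset.sum_nbij' (insert i) (fun S => S.erase i) ?_ ?_ ?_ ?_ ?_
    · simp
    · simp
    · intro T hT
      exact Finset.erase_insert (Finset.mem_filter.1 hT).2
    · intro S hS
      exact Finset.insert_erase (Finset.mem_filter.1 hS).2
    · intro T hT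
      rw [fourierCoeff_pderiv i f (Finset.mem_filter.1 hT).2]
  simp only [h1]
  rw [Finset.sum_comm]
  conv_rhs => rw [← sum_smul_walsh_of_mem hf, Finset.smul_sum]
  refine Eq.trans ?_ (Finset.sum_subset (Finset.subset_univ (homog N d)) fun S _ hS => ?_).symm
  · refine Finset.sum_congr rfl fun S _ => ?_
    simp only [Finset.sum_ite_mem, Finset.univ_inter, Finset.sum_const]
    by_cases hS : S ∈ homog N d
    · rw [(Finset.mem_powersetCard.1 hS).2, Nat.cast_smul_eq_nsmul]
    · simp [hf S hS]
  · rw [hf S hS, zero_smul, smul_zero]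

theorem affineExt_sum_smul (u : Fin N → ℝ) (h : Fin N → Cube N → ℝ) (v : Fin N → ℝ) :
    affineExt (∑ i, u i • h i) v =
      ∑ i, ∑ T, fourierCoeff T (h i) * (u i * ∏ k ∈ T, v k) := by
  simp only [affineExt, map_sum, map_smul, smul_eq_mul, Finset.sum_mul]
  rw [Finset.sum_comm]
  exact Finset.sum_congr rfl fun i _ => Finset.sum_congr rfl fun T _ => by ring

/-- If `i ∈ T`, no subset `A` contains `i` and is disjoint from `T`. -/
theorem decouple_of_mem {i : Fin N} {T : Finset (Fin N)} (hi : i ∈ T) (x : Cube N)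
    (A : Finset (Fin N)) : (if i ∈ A then ((x i : ℤ) : ℝ) else 0) *
      ∏ k ∈ T, (if k ∈ A then 0 else ((x k : ℤ) : ℝ)) = 0 := by
  by_cases h : i ∈ A
  · rw [Finset.prod_eq_zero hi (by simp [h]), mul_zero]
  · simp [h]

/-- If `i ∉ T`, then `2 ^ (N - |T| - 1)` subsets `A` contain `i` and are disjoint from `T`. -/
theorem sum_decouple_of_notMem {i : Fin N} {T : Finset (Fin N)} (hi : i ∉ T) (x : Cube N) :
    ∑ A : Finset (Fin N), (if i ∈ A then ((x i : ℤ) : ℝ) else 0) *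
      ∏ k ∈ T, (if k ∈ A then 0 else ((x k : ℤ) : ℝ)) =
      2 ^ (N - (T.card + 1)) * walsh (insert i T) x := by
  have h : ∀ A : Finset (Fin N), (if i ∈ A then ((x i : ℤ) : ℝ) else 0) *
      ∏ k ∈ T, (if k ∈ A then 0 else ((x k : ℤ) : ℝ)) =
      if A ∈ Finset.Icc {i} Tᶜ then walsh (insert i T) x else 0 := by
    intro A
    by_cases h1 : i ∈ A
    · by_cases h2 : A ⊆ Tᶜ
      · rw [if_pos h1, if_pos (Finset.mem_Icc.2 ⟨Finset.singleton_subset_iff.2 h1, h2⟩),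
          walsh_insert hi, walsh]
        refine congrArg _ (Finset.prod_congr rfl fun k hk => if_neg fun hkA => ?_)
        exact Finset.mem_compl.1 (h2 hkA) hk
      · rw [if_neg fun h => h2 (Finset.mem_Icc.1 h).2]
        obtain ⟨k, hkA, hkT⟩ := Finset.not_subset.1 h2
        rw [Finset.prod_eq_zero (i := k) (by simpa using hkT) (by simp [hkA]), mul_zero]
    · rw [if_neg h1, zero_mul, if_neg fun h =>
        h1 (Finset.singleton_subset_iff.1 (Finset.mem_Icc.1 h).1)]
  rw [Finset.sum_congr rfl fun A _ => h A, Finset.sum_ite_mem, Finset.univ_inter,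
    Finset.sum_const, Finset.card_Icc_finset (by simpa using hi), Finset.card_compl,
    Fintype.card_fin, Finset.card_singleton, Nat.sub_sub, nsmul_eq_mul]
  push_cast
  rfl

/-- Decoupling: the tetrahedral part is `2 ^ d` times the average over `A ⊆ [N]` of
`∑ u_i h_i(v)`, where `u` and `v` are the restrictions of `x` to `A` and to its complement. -/
theorem abs_tetra_le {𝒯 : Finset (Finset (Fin N))} {d : ℕ} (h𝒯 : ∀ T ∈ 𝒯, T.card + 1 = d)
    {h : Fin N → Cube N → ℝ} (hh : ∀ i, h i ∈ walshSpace 𝒯) {M : ℝ}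
    (hM : ∀ u : Fin N → ℝ, (∀ i, |u i| ≤ 1) → ‖∑ i, u i • h i‖ ≤ M) (x : Cube N) :
    |tetra h x| ≤ 2 ^ d * M := by
  have key : 2 ^ N * tetra h x = 2 ^ d * ∑ A : Finset (Fin N),
      affineExt (∑ i, (if i ∈ A then ((x i : ℤ) : ℝ) else 0) • h i)
        (fun k => if k ∈ A then 0 else ((x k : ℤ) : ℝ)) := by
    simp only [affineExt_sum_smul]
    rw [Finset.sum_comm, tetra_apply, Finset.sum_apply, Finset.mul_sum, Finset.mul_sum]
    refine Finset.sum_congr rfl fun i _ => ?_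
    rw [Finset.sum_comm, Finset.sum_apply, Finset.mul_sum, Finset.mul_sum, Finset.sum_filter]
    refine Finset.sum_congr rfl fun T _ => ?_
    rw [← Finset.mul_sum]
    by_cases hi : i ∈ T
    · rw [if_neg (not_not.2 hi), Finset.sum_eq_zero fun A _ => decouple_of_mem hi x A]
      simp
    · rw [if_pos hi, sum_decouple_of_notMem hi]
      by_cases hT : T ∈ 𝒯
      · have hc : T.card + 1 ≤ N := by
          rw [← Finset.card_insert_of_notMem hi]
          simpa using Finset.card_le_univ (insert i T)
        have : (2 : ℝ) ^ N = 2 ^ d * 2 ^ (N - (T.card + 1)) := by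
          rw [← h𝒯 T hT, ← pow_add, Nat.add_sub_cancel' hc]
        rw [this, Pi.smul_apply, smul_eq_mul]
        ring
      · simp [hh i T hT]
  have hb : |∑ A : Finset (Fin N), affineExt (∑ i, (if i ∈ A then ((x i : ℤ) : ℝ) else 0) • h i)
        (fun k => if k ∈ A then 0 else ((x k : ℤ) : ℝ))| ≤ 2 ^ N * M := by
    refine (Finset.abs_sum_le_sum_abs _ _).trans ?_
    calc _ ≤ ∑ A : Finset (Fin N), M := by
          refine Finset.sum_le_sum fun A _ => (abs_affineExt_le _ fun k => ?_).trans
            (hM _ fun i => ?_)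
          · split_ifs
            · simp
            · exact abs_coord_le_one x k
          · split_ifs
            · exact abs_coord_le_one x i
            · simp
      _ = 2 ^ N * M := by simp
  have h2 : (0 : ℝ) < 2 ^ N := by positivity
  have h3 : 2 ^ N * |tetra h x| ≤ 2 ^ N * (2 ^ d * M) := by
    rw [← abs_of_pos h2, ← abs_mul, key, abs_mul, abs_of_pos (by positivity : (0 : ℝ) < 2 ^ d),
      abs_of_pos h2]
    nlinarith [mul_le_mul_of_nonneg_left hb (by positivity : (0 : ℝ) ≤ 2 ^ d)]
  exact le_of_mul_le_mul_left h3 h2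

end Tetrahedral

/-! ### The reproducing system of a homogeneous Walsh space -/

section Frames

variable {N : ℕ}

/-- The reproducing system with functionals `f ↦ D_i f(y)`, for `y` in the cube and `i ∈ [N]`. The
synthesis operator sends `(g_i)` to `d⁻¹ 𝐐` of the tetrahedral part of `∑ x_i (P g_i)(x)`. -/
theorem hasUncondFrame_homogeneous {d : ℕ} (hd : 1 ≤ d) {𝒮 : Finset (Finset (Fin N))}
    (h𝒮 : ∀ S ∈ 𝒮, S.card = d) (P : (Cube N → ℝ) →ₗ[ℝ] (Cube N → ℝ))
    (hPmem : ∀ g, P g ∈ walshSpace (flat 𝒮)) (hPid : ∀ g ∈ walshSpace (flat 𝒮), P g = g)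
    {L : ℝ} (hL0 : 0 ≤ L) (hL : ∀ g, ‖P g‖ ≤ L * ‖g‖) :
    HasUncondFrame (walshSpace 𝒮)
      (Real.exp 1 * (2 * √2) ^ d * ‖coeffProj (homog N d) 𝒮‖ * L) := by
  have hsub : walshSpace 𝒮 ≤ walshSpace (homog N d) := walshSpace_mono fun S hS =>
    Finset.mem_powersetCard.2 ⟨Finset.subset_univ _, h𝒮 S hS⟩
  have hflat : ∀ T ∈ flat 𝒮, T.card + 1 = d := fun T hT => card_of_mem_flat h𝒮 hT
  have hd0 : (0 : ℝ) < d := by exact_mod_cast hd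
  let C : ((Cube N × Fin N) → ℝ) →ₗ[ℝ] (Fin N → Cube N → ℝ) :=
    LinearMap.pi fun i => P ∘ₗ LinearMap.funLeft ℝ ℝ fun y => (y, i)
  have hC : ∀ g i, C g i = P fun y => g (y, i) := fun _ _ => rfl
  let A : walshSpace 𝒮 →ₗ[ℝ] ((Cube N × Fin N) → ℝ) :=
    LinearMap.pi fun p => LinearMap.proj p.1 ∘ₗ pderiv p.2 ∘ₗ (walshSpace 𝒮).subtype
  have hA : ∀ f p, A f p = pderiv p.2 (f : Cube N → ℝ) p.1 := fun _ _ => rfl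
  let B : ((Cube N × Fin N) → ℝ) →ₗ[ℝ] walshSpace 𝒮 := (d : ℝ)⁻¹ •
    ((coeffProj (homog N d) 𝒮).toLinearMap ∘ₗ LinearMap.codRestrict (walshSpace (homog N d))
      (tetra ∘ₗ C) fun g => tetra_mem hflat fun i => hPmem _)
  have hB : ∀ g, B g = (d : ℝ)⁻¹ • coeffProj (homog N d) 𝒮
    ⟨tetra (C g), tetra_mem hflat fun i => hPmem _⟩ := fun _ => rfl
  refine ⟨Cube N × Fin N, inferInstance, A, B, fun f => ?_, fun f ε hε => ?_⟩
  · have h1 : C (A f) = fun i => pderiv i (f : Cube N → ℝ) :=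
      funext fun i => hPid _ (pderiv_mem_flat f.2 i)
    apply Subtype.ext
    have h2 : tetra (C (A f)) = (d : ℝ) • (f : Cube N → ℝ) := by
      rw [h1, tetra_pderiv (hsub f.2)]
    have h3 : tetra (C (A f)) ∈ walshSpace 𝒮 := h2 ▸ Submodule.smul_mem _ _ f.2
    rw [hB, Submodule.coe_smul]
    refine (congrArg ((d : ℝ)⁻¹ • ·) ((coeffProj_apply_of_mem _ h3).trans h2)).trans ?_
    exact inv_smul_smul₀ hd0.ne' _
  · set D : ℝ := Real.exp 1 * d * √2 ^ d * ‖f‖ with hD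
    have hD0 : 0 ≤ D := by positivity
    have hM : ∀ u : Fin N → ℝ, (∀ i, |u i| ≤ 1) → ‖∑ i, u i • C (ε * A f) i‖ ≤ L * D := by
      intro u hu
      have h1 : ∑ i, u i • C (ε * A f) i = P (∑ i, u i • fun y => (ε * A f) (y, i)) := by
        simp only [map_sum, map_smul, hC]
      rw [h1]
      refine (hL _).trans (mul_le_mul_of_nonneg_left ?_ hL0)
      refine (pi_norm_le_iff_of_nonneg hD0).2 fun y => ?_
      refine le_trans ?_ (sum_abs_pderiv_le hd (hsub f.2) y)
      rw [Finset.sum_apply]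
      refine (norm_sum_le _ _).trans (Finset.sum_le_sum fun i _ => ?_)
      rw [Pi.smul_apply, smul_eq_mul, Pi.mul_apply, hA, Real.norm_eq_abs, abs_mul, abs_mul]
      have h2 := mul_le_one₀ (hu i) (abs_nonneg _) (hε (y, i))
      rw [← mul_assoc]
      exact mul_le_of_le_one_left (abs_nonneg _) h2
    have ht : ‖tetra (C (ε * A f))‖ ≤ 2 ^ d * (L * D) :=
      (pi_norm_le_iff_of_nonneg (by positivity)).2 fun x =>
        abs_tetra_le hflat (fun i => hPmem _) hM x
    rw [hB, norm_smul, norm_inv, Real.norm_of_nonneg hd0.le]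
    have hQ := (coeffProj (homog N d) 𝒮).le_opNorm
      ⟨tetra (C (ε * A f)), tetra_mem hflat fun i => hPmem _⟩
    have hQ' := hQ.trans (mul_le_mul_of_nonneg_left ht (norm_nonneg _))
    refine (mul_le_mul_of_nonneg_left hQ' (by positivity)).trans (le_of_eq ?_)
    rw [hD, mul_pow]
    field_simp

/-- The projection constant bounds the norm of some projection of `ℓ_∞(cube)` onto a Walsh space;
the projection is returned as an endomorphism of `ℓ_∞(cube)`. -/
theorem exists_projection_of_projConst_lt {𝒯 : Finset (Finset (Fin N))} {L : ℝ}
    (h : projConst (walshSpace 𝒯) < ENNReal.ofReal L) :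
    ∃ P : (Cube N → ℝ) →ₗ[ℝ] (Cube N → ℝ), (∀ g, P g ∈ walshSpace 𝒯) ∧
      (∀ g ∈ walshSpace 𝒯, P g = g) ∧ ∀ g, ‖P g‖ ≤ L * ‖g‖ := by
  have h1 : relProjConst (LinearMap.range (walshSpace 𝒯).subtypeₗᵢ.toLinearMap) <
      ENNReal.ofReal L := by
    refine lt_of_le_of_lt ?_ h
    exact (le_iSup (fun I : walshSpace 𝒯 →ₗᵢ[ℝ] (Cube N → ℝ) =>
      relProjConst (LinearMap.range I.toLinearMap)) _).trans <|
      le_iSup_of_le (Cube N → ℝ) <| le_iSup_of_le inferInstance <|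
      le_iSup_of_le inferInstance <| le_iSup_of_le inferInstance le_rfl
  simp only [relProjConst, iInf_lt_iff] at h1
  obtain ⟨P, hP, hPL⟩ := h1
  have hr : LinearMap.range (walshSpace 𝒯).subtypeₗᵢ.toLinearMap = walshSpace 𝒯 :=
    Submodule.range_subtype _
  refine ⟨(Submodule.subtype _) ∘ₗ P.toLinearMap, fun g => ?_, fun g hg => ?_, fun g => ?_⟩
  · exact hr.le (P g).2
  · have hg' : g ∈ LinearMap.range (walshSpace 𝒯).subtypeₗᵢ.toLinearMap := by rwa [hr]
    exact congrArg Subtype.val (hP ⟨g, hg'⟩)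
  · rw [← ofReal_norm] at hPL
    have hPL' : ‖P‖ ≤ L := (ENNReal.ofReal_lt_ofReal_iff'.1 hPL).1.le
    exact (P.le_opNorm g).trans (mul_le_mul_of_nonneg_right hPL' (norm_nonneg g))

theorem one_le_of_projConst_lt {𝒯 : Finset (Finset (Fin N))} (h𝒯 : 𝒯.Nonempty) {L : ℝ}
    (h : projConst (walshSpace 𝒯) < ENNReal.ofReal L) : 1 ≤ L := by
  obtain ⟨T, hT⟩ := h𝒯
  obtain ⟨P, -, hP, hL⟩ := exists_projection_of_projConst_lt h
  simpa [hP _ (walsh_mem hT), norm_walsh] using hL (walsh T)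

theorem one_le_norm_coeffProj {𝒜 𝒮 : Finset (Finset (Fin N))} (h : 𝒮 ⊆ 𝒜) (h𝒮 : 𝒮.Nonempty) :
    1 ≤ ‖coeffProj 𝒜 𝒮‖ := by
  obtain ⟨S, hS⟩ := h𝒮
  have h1 := (coeffProj 𝒜 𝒮).le_opNorm ⟨walsh S, walsh_mem (h hS)⟩
  have h2 : ‖coeffProj 𝒜 𝒮 ⟨walsh S, walsh_mem (h hS)⟩‖ = 1 := by
    rw [← Submodule.norm_coe, coeffProj_apply_of_mem _ (walsh_mem hS), norm_walsh]
  rw [h2] at h1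
  simpa [norm_walsh] using h1

theorem hasUncondFrame_zero_of_subsingleton {X : Type} [NormedAddCommGroup X] [NormedSpace ℝ X]
    [Subsingleton X] : HasUncondFrame X 0 :=
  ⟨Empty, inferInstance, 0, 0, fun _ => Subsingleton.elim _ _,
    fun f ε _ => by simp⟩

theorem walshSpace_empty : walshSpace (∅ : Finset (Finset (Fin N))) = ⊥ := by
  refine (Submodule.eq_bot_iff _).2 fun f hf => ?_
  rw [← sum_smul_walsh_of_mem hf, Finset.sum_empty]

theorem glConst_walshSpace_empty : glConst (walshSpace (∅ : Finset (Finset (Fin N)))) = 0 := by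
  have : Subsingleton (walshSpace (∅ : Finset (Finset (Fin N)))) := by
    rw [walshSpace_empty]; infer_instance
  simpa using glConst_le_of_frame le_rfl (hasUncondFrame_zero_of_subsingleton
    (X := walshSpace (∅ : Finset (Finset (Fin N)))))

end Frames

/-! ### A lower bound for `κ` -/

section Kappa

theorem sinc_pi_div_pos {p : ℕ} (hp : 2 ≤ p) : 0 < Real.sinc (Real.pi / p) := by
  have hp' : (2 : ℝ) ≤ p := by exact_mod_cast hp
  have h0 : 0 < Real.pi / p := by positivity
  rw [Real.sinc_of_ne_zero h0.ne']
  refine div_pos (Real.sin_pos_of_pos_of_lt_pi h0 ?_) h0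
  rw [div_lt_iff₀ (by linarith)]
  nlinarith [Real.pi_pos]

/-- The product converges to a nonzero limit, so that `κ` is not a junk inverse of `0`. -/
theorem tprod_sinc_ne_zero : ∏' p : Nat.Primes, Real.sinc (Real.pi / (p : ℕ)) ≠ 0 := by
  have hs : Summable fun p : Nat.Primes => ‖Real.sinc (Real.pi / (p : ℕ)) - 1‖ := by
    have h3 : Summable fun n : ℕ => Real.pi ^ 2 * (1 / (n : ℝ) ^ 2) :=
      (Real.summable_one_div_nat_pow.2 one_lt_two).mul_left _
    refine Summable.of_nonneg_of_le (fun _ => norm_nonneg _) (fun p => ?_)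
      (h3.subtype {p | p.Prime})
    have hx : 0 < Real.pi / (p : ℕ) := div_pos Real.pi_pos (by exact_mod_cast p.2.pos)
    have h1 := Real.sin_gt_sub_cube hx
    have h2 := Real.sinc_le_one (Real.pi / (p : ℕ))
    rw [Real.norm_eq_abs, abs_of_nonpos (by linarith)]
    have h3 : 1 - (Real.pi / (p : ℕ)) ^ 2 ≤ Real.sinc (Real.pi / (p : ℕ)) := by
      rw [Real.sinc_of_ne_zero hx.ne', le_div_iff₀ hx]
      nlinarith [pow_pos hx 3]
    change _ ≤ Real.pi ^ 2 * (1 / ((p.1 : ℕ) : ℝ) ^ 2)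
    rw [div_pow] at h3
    rw [mul_one_div]
    linarith
  have h1 := tprod_one_add_ne_zero_of_summable
    (f := fun p : Nat.Primes => Real.sinc (Real.pi / (p : ℕ)) - 1)
    (fun p => by simpa using (sinc_pi_div_pos p.2.two_le).ne') hs
  simpa using h1

theorem tprod_sinc_bounds : 0 ≤ ∏' p : Nat.Primes, Real.sinc (Real.pi / (p : ℕ)) ∧
    ∏' p : Nat.Primes, Real.sinc (Real.pi / (p : ℕ)) ≤
      Real.sinc (Real.pi / 2) * Real.sinc (Real.pi / 3) := by
  have h : Filter.Tendsto (fun s : Finset Nat.Primes => ∏ p ∈ s, Real.sinc (Real.pi / (p : ℕ)))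
      Filter.atTop (nhds (∏' p : Nat.Primes, Real.sinc (Real.pi / (p : ℕ)))) := by
    have := multipliable_sinc_primes.hasProd
    rwa [HasProd, SummationFilter.unconditional_filter] at this
  have hpos : ∀ p : Nat.Primes, 0 ≤ Real.sinc (Real.pi / (p : ℕ)) := fun p =>
    (sinc_pi_div_pos p.2.two_le).le
  refine ⟨ge_of_tendsto' h fun s => Finset.prod_nonneg fun p _ => hpos p, ?_⟩
  let t : Finset Nat.Primes := {⟨2, Nat.prime_two⟩, ⟨3, Nat.prime_three⟩}
  have ht : ∏ p ∈ t, Real.sinc (Real.pi / (p : ℕ)) =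
      Real.sinc (Real.pi / 2) * Real.sinc (Real.pi / 3) := by
    refine (Finset.prod_pair (show (⟨2, Nat.prime_two⟩ : Nat.Primes) ≠ ⟨3, Nat.prime_three⟩ by
      decide)).trans ?_
    norm_num
  refine le_of_tendsto h ((Filter.eventually_ge_atTop t).mono fun s hs => ?_)
  rw [← Finset.prod_sdiff hs, ht]
  refine mul_le_of_le_one_left ?_ (Finset.prod_le_one (fun p _ => hpos p) fun p _ =>
    Real.sinc_le_one _)
  rw [← ht]
  exact Finset.prod_nonneg fun p _ => hpos p

theorem kappa_pos : 0 < kappa :=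
  inv_pos.2 (lt_of_le_of_ne tprod_sinc_bounds.1 tprod_sinc_ne_zero.symm)

/-- The factors at `2` and `3` alone give `κ ≥ π² / (3√3) ≥ √3`. -/
theorem three_le_kappa_sq : 3 ≤ kappa ^ 2 := by
  have h1 := tprod_sinc_bounds.2
  have h0 := lt_of_le_of_ne tprod_sinc_bounds.1 tprod_sinc_ne_zero.symm
  rw [kappa]
  set T := ∏' p : Nat.Primes, Real.sinc (Real.pi / (p : ℕ))
  have hpi := Real.pi_gt_three
  have h2 : Real.sinc (Real.pi / 2) * Real.sinc (Real.pi / 3) = 3 * √3 / Real.pi ^ 2 := by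
    rw [Real.sinc_of_ne_zero (by positivity), Real.sinc_of_ne_zero (by positivity),
      Real.sin_pi_div_two, Real.sin_pi_div_three]
    field_simp
  rw [h2, le_div_iff₀ (by positivity)] at h1
  have h3 : T * 9 ≤ 3 * √3 :=
    (mul_le_mul_of_nonneg_left (by nlinarith) h0.le).trans h1
  have h4 : √3 ^ 2 = 3 := Real.sq_sqrt (by norm_num)
  have h5 : 3 * T ^ 2 ≤ 1 := by nlinarith [Real.sqrt_nonneg 3]
  rw [inv_pow, le_inv_comm₀ (by norm_num) (by positivity)]
  linarith

/-- Comparison of the constant `e (2√2)^d` with `d (2κ)^d`. In terms of `r = κ / √2` it reads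
`e ≤ d r ^ d`, and `r ^ 2 ≥ 3 / 2` yields `d r ^ d ≥ 3`. -/
theorem exp_one_mul_pow_le {d : ℕ} (hd : 2 ≤ d) :
    Real.exp 1 * (2 * √2) ^ d ≤ d * kappa ^ d * 2 ^ d := by
  have h2 : (0 : ℝ) < √2 := by positivity
  have h22 : √2 ^ 2 = 2 := Real.sq_sqrt (by norm_num)
  have hk := kappa_pos
  have hk2 := three_le_kappa_sq
  set r := kappa / √2 with hr
  have hr0 : 0 < r := div_pos hk h2
  have hr2 : 3 / 2 ≤ r ^ 2 := by
    rw [hr, div_pow, h22]; linarith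
  have hr1 : 1 ≤ r := by nlinarith
  have hrd : 3 / 2 ≤ r ^ d := hr2.trans (pow_le_pow_right₀ hr1 hd)
  have hd' : (2 : ℝ) ≤ d := by exact_mod_cast hd
  have he : Real.exp 1 ≤ d * r ^ d := by
    have := Real.exp_one_lt_d9
    nlinarith
  have hkr : kappa = r * √2 := by rw [hr]; field_simp
  calc Real.exp 1 * (2 * √2) ^ d ≤ d * r ^ d * (2 * √2) ^ d := by gcongr
    _ = d * kappa ^ d * 2 ^ d := by rw [hkr, mul_pow, mul_pow]; ring

end Kappa

/-! ### The decomposition into levels -/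

section Levels

variable {N : ℕ}

theorem norm_coeffProj_level_le {𝒮 : Finset (Finset (Fin N))} {d : ℕ}
    (h𝒮 : ∀ S ∈ 𝒮, S.card ≤ d) (k : ℕ) (f : walshSpace 𝒮) :
    ‖coeffProj 𝒮 (level 𝒮 k) f‖ ≤ (1 + √2) ^ d * ‖f‖ := by
  rw [← Submodule.norm_coe, coeffProj_apply]
  refine (pi_norm_le_iff_of_nonneg (by positivity)).2 fun x => ?_
  have h1 : (∑ S ∈ level 𝒮 k, fourierCoeff S (f : Cube N → ℝ) • walsh S) x =
      ∑ S with S.card = k, fourierCoeff S (f : Cube N → ℝ) * walsh S x := by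
    rw [Finset.sum_apply]
    refine Finset.sum_subset (Finset.filter_subset_filter _ (Finset.subset_univ 𝒮))
      fun S hS hS' => ?_
    have : S ∉ 𝒮 := fun h => hS' (Finset.mem_filter.2 ⟨h, (Finset.mem_filter.1 hS).2⟩)
    simp [f.2 S this]
  rw [h1]
  exact abs_sum_level_le (fun S hS => f.2 S fun h => absurd (h𝒮 S h) (not_le.2 hS)) k x

theorem hasUncondFrame_of_levels {𝒮 : Finset (Finset (Fin N))} {d : ℕ}
    (h𝒮 : ∀ S ∈ 𝒮, S.card ≤ d) {K : Fin (d + 1) → ℝ} (hK0 : ∀ k, 0 ≤ K k)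
    (h : ∀ k : Fin (d + 1), HasUncondFrame (walshSpace (level 𝒮 k)) (K k)) :
    HasUncondFrame (walshSpace 𝒮) ((1 + √2) ^ d * ∑ k, K k) := by
  refine HasUncondFrame.of_sum (fun k : Fin (d + 1) => (coeffProj 𝒮 (level 𝒮 k)).toLinearMap)
    (fun k => Submodule.inclusion (walshSpace_mono (Finset.filter_subset _ _))) (fun f => ?_)
    (fun k f => norm_coeffProj_level_le h𝒮 k f) (fun k z => ?_) hK0 h
  swap
  · rw [← Submodule.norm_coe, ← Submodule.norm_coe z, Submodule.coe_inclusion]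
  apply Subtype.ext
  rw [Submodule.coe_sum]
  have h1 : ∀ k : Fin (d + 1), ((Submodule.inclusion (walshSpace_mono (Finset.filter_subset _ _))
      (coeffProj 𝒮 (level 𝒮 k) f) : walshSpace 𝒮) : Cube N → ℝ) =
      ∑ S ∈ level 𝒮 k, fourierCoeff S (f : Cube N → ℝ) • walsh S :=
    fun k => coeffProj_apply 𝒮 (level 𝒮 k) f
  refine (Finset.sum_congr rfl fun k _ => h1 k).trans ?_
  rw [Fin.sum_univ_eq_sum_range
    (fun k => ∑ S ∈ level 𝒮 k, fourierCoeff S (f : Cube N → ℝ) • walsh S) (d + 1)]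
  conv_rhs => rw [← sum_smul_walsh_of_mem f.2]
  exact Finset.sum_fiberwise_of_maps_to
    (fun S hS => Finset.mem_range.2 (Nat.lt_succ_of_le (h𝒮 S hS))) _

theorem hasUncondFrame_singleton (S : Finset (Fin N)) :
    HasUncondFrame (walshSpace {S}) 1 := by
  have hS : walsh S ∈ walshSpace {S} := walsh_mem (Finset.mem_singleton_self S)
  have hf : ∀ f : walshSpace {S}, fourierCoeff S (f : Cube N → ℝ) • (⟨walsh S, hS⟩ : walshSpace {S})
      = f := fun f => Subtype.ext (by
    conv_rhs => rw [← sum_smul_walsh_of_mem f.2, Finset.sum_singleton]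
    rfl)
  refine ⟨Unit, inferInstance,
    LinearMap.pi fun _ => fourierCoeff S ∘ₗ (walshSpace {S}).subtype,
    (LinearMap.proj () : (Unit → ℝ) →ₗ[ℝ] ℝ).smulRight ⟨walsh S, hS⟩, hf, fun f ε hε => ?_⟩
  have h1 : (LinearMap.proj () : (Unit → ℝ) →ₗ[ℝ] ℝ).smulRight (⟨walsh S, hS⟩ : walshSpace {S})
      (ε * (LinearMap.pi fun _ => fourierCoeff S ∘ₗ (walshSpace {S}).subtype : _ →ₗ[ℝ] Unit → ℝ) f)
      = ε () • f := by
    conv_rhs => rw [← hf f, smul_smul]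
    rfl
  rw [h1, norm_smul]
  exact mul_le_mul_of_nonneg_right (hε ()) (norm_nonneg f)

/-- The level `0` contains at most the constant functions. -/
theorem hasUncondFrame_level_zero (𝒮 : Finset (Finset (Fin N))) :
    HasUncondFrame (walshSpace (level 𝒮 0)) 1 := by
  have h : level 𝒮 0 ⊆ {∅} := fun S hS =>
    Finset.mem_singleton.2 (Finset.card_eq_zero.1 (Finset.mem_filter.1 hS).2)
  rcases Finset.subset_singleton_iff.1 h with h | h
  · rw [h]
    have : Subsingleton (walshSpace (∅ : Finset (Finset (Fin N)))) := by
      rw [walshSpace_empty]; infer_instance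
    exact hasUncondFrame_zero_of_subsingleton.mono zero_le_one
  · rw [h]
    exact hasUncondFrame_singleton ∅

end Levels

/-! ### The bounds for the Gordon–Lewis constant -/

section Main

variable {N : ℕ}

/-- To bound `x` by `c Λ` it suffices to use real numbers `L > Λ`; this covers `Λ = ∞`. -/
theorem le_mul_of_forall_lt_ofReal {x c Λ : ℝ≥0∞} (hc0 : c ≠ 0) (hc : c ≠ ∞)
    (h : ∀ L : ℝ, Λ < ENNReal.ofReal L → x ≤ c * ENNReal.ofReal L) : x ≤ c * Λ := by
  rw [mul_comm, ← ENNReal.div_le_iff hc0 hc]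
  refine le_of_forall_gt_imp_ge_of_dense fun b hb => ?_
  rcases eq_or_ne b ∞ with rfl | hb'
  · exact le_top
  · rw [ENNReal.div_le_iff hc0 hc, mul_comm, ← ENNReal.ofReal_toReal hb']
    exact h _ (by rwa [ENNReal.ofReal_toReal hb'])

theorem glConst_le_homogeneous {d : ℕ} (hd : 2 ≤ d) {𝒮 : Finset (Finset (Fin N))}
    (h𝒮 : ∀ S ∈ 𝒮, S.card = d) :
    glConst (walshSpace 𝒮) ≤ ENNReal.ofReal (2 * d * kappa ^ d * 2 ^ (d - 1)) *
      ‖coeffProj (homog N d) 𝒮‖ₑ * projConst (walshSpace (flat 𝒮)) := by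
  rcases 𝒮.eq_empty_or_nonempty with rfl | hne
  · rw [glConst_walshSpace_empty]; exact zero_le
  have hk := kappa_pos
  have hd0 : 0 < d := by omega
  have hQ := one_le_norm_coeffProj (𝒜 := homog N d) (fun S hS =>
    Finset.mem_powersetCard.2 ⟨Finset.subset_univ _, h𝒮 S hS⟩) hne
  rw [← ofReal_norm, ← ENNReal.ofReal_mul (by positivity)]
  refine le_mul_of_forall_lt_ofReal ?_ ENNReal.ofReal_ne_top fun L hL => ?_
  · rw [ne_eq, ENNReal.ofReal_eq_zero, not_le]
    have : (0 : ℝ) < d := by exact_mod_cast hd0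
    positivity
  obtain ⟨P, h1, h2, h3⟩ := exists_projection_of_projConst_lt hL
  have hL0 : 0 < L := by
    by_contra hneg
    rw [ENNReal.ofReal_of_nonpos (not_lt.1 hneg)] at hL
    exact not_lt_zero hL
  refine (glConst_le_of_frame (by positivity)
    (hasUncondFrame_homogeneous (by omega) h𝒮 P h1 h2 hL0.le h3)).trans ?_
  rw [← ENNReal.ofReal_mul (by positivity)]
  refine ENNReal.ofReal_le_ofReal ?_
  refine mul_le_mul_of_nonneg_right (mul_le_mul_of_nonneg_right
    ((exp_one_mul_pow_le hd).trans (le_of_eq ?_)) (norm_nonneg _)) hL0.le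
  obtain ⟨e, rfl⟩ : ∃ e, d = e + 1 := ⟨d - 1, by omega⟩
  rw [Nat.add_sub_cancel]
  ring

theorem glConst_le_of_card_le {d : ℕ} (hd : 2 ≤ d) {𝒮 : Finset (Finset (Fin N))}
    (h𝒮 : ∀ S ∈ 𝒮, S.card ≤ d) (hne : 𝒮 ≠ {∅}) :
    glConst (walshSpace 𝒮) ≤
      ENNReal.ofReal ((d + 1) * (1 + √2) ^ d * (2 * d) * kappa ^ d * 2 ^ d) *
        (⨆ k ∈ Finset.Icc 1 d, ‖coeffProj (homog N k) (level 𝒮 k)‖ₑ) *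
        (⨆ k ∈ Finset.Icc 1 d, projConst (walshSpace (flat (level 𝒮 k)))) := by
  rcases 𝒮.eq_empty_or_nonempty with rfl | hne'
  · rw [glConst_walshSpace_empty]; exact zero_le
  -- Some level `k ≥ 1` is nonempty. There `‖𝐐_k‖ ≥ 1` and `λ ≥ 1`, so that the asserted bound also
  -- absorbs the constant `1` of the level `0`.
  obtain ⟨S₀, hS₀, hS₀'⟩ : ∃ S ∈ 𝒮, S ≠ ∅ := by
    by_contra! hcon
    exact hne (Finset.eq_singleton_iff_nonempty_unique_mem.2 ⟨hne', hcon⟩)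
  have hk₀ : S₀.card ∈ Finset.Icc 1 d :=
    Finset.mem_Icc.2 ⟨Finset.card_pos.2 (Finset.nonempty_iff_ne_empty.2 hS₀'), h𝒮 S₀ hS₀⟩
  have hlev : S₀ ∈ level 𝒮 S₀.card := Finset.mem_filter.2 ⟨hS₀, rfl⟩
  have hcard : ∀ k, ∀ S ∈ level 𝒮 k, S.card = k := fun k S hS => (Finset.mem_filter.1 hS).2
  have hsub : ∀ k, level 𝒮 k ⊆ homog N k := fun k S hS =>
    Finset.mem_powersetCard.2 ⟨Finset.subset_univ _, hcard k S hS⟩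
  set Q : ℝ≥0∞ := ⨆ k ∈ Finset.Icc 1 d, ‖coeffProj (homog N k) (level 𝒮 k)‖ₑ with hQ
  set Λ : ℝ≥0∞ := ⨆ k ∈ Finset.Icc 1 d, projConst (walshSpace (flat (level 𝒮 k))) with hΛ
  have hQtop : Q ≠ ∞ := by
    refine ne_top_of_le_ne_top
      (ENNReal.sum_ne_top.2 fun k (_ : k ∈ Finset.Icc 1 d) => enorm_ne_top)
      (iSup₂_le fun k hk => Finset.single_le_sum
        (f := fun k => ‖coeffProj (homog N k) (level 𝒮 k)‖ₑ) (fun _ _ => zero_le) hk)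
  set q := Q.toReal with hq
  have hQq : ∀ k ∈ Finset.Icc 1 d, ‖coeffProj (homog N k) (level 𝒮 k)‖ ≤ q := by
    intro k hk
    rw [← toReal_enorm]
    exact ENNReal.toReal_mono hQtop
      (le_iSup₂_of_le (f := fun k _ => ‖coeffProj (homog N k) (level 𝒮 k)‖ₑ) k hk le_rfl)
  have hq1 : 1 ≤ q := (one_le_norm_coeffProj (hsub _) ⟨S₀, hlev⟩).trans (hQq _ hk₀)
  have hk := kappa_pos
  have hd0 : (0 : ℝ) < d := by exact_mod_cast (by omega : 0 < d)
  rw [← ENNReal.ofReal_toReal hQtop, ← hq, ← ENNReal.ofReal_mul (by positivity)]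
  refine le_mul_of_forall_lt_ofReal ?_ ENNReal.ofReal_ne_top fun L hL => ?_
  · rw [ne_eq, ENNReal.ofReal_eq_zero, not_le]
    positivity
  have hLk : ∀ k ∈ Finset.Icc 1 d,
      projConst (walshSpace (flat (level 𝒮 k))) < ENNReal.ofReal L := fun k hk =>
    (le_iSup₂_of_le (f := fun k _ => projConst (walshSpace (flat (level 𝒮 k)))) k hk
      le_rfl).trans_lt hL
  have hL1 : 1 ≤ L := by
    obtain ⟨i, hi⟩ := Finset.nonempty_iff_ne_empty.2 hS₀'
    exact one_le_of_projConst_lt ⟨S₀ \ {i}, Finset.mem_biUnion.2 ⟨S₀, hlev,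
      Finset.mem_image_of_mem _ hi⟩⟩ (hLk _ hk₀)
  set E := Real.exp 1 * (2 * √2) ^ d with hE
  have h22 : 1 ≤ 2 * √2 := by
    have := Real.one_lt_sqrt_two; linarith
  have hE1 : 1 ≤ E := by
    have h1 : 1 ≤ (2 * √2) ^ d := one_le_pow₀ h22
    have h2 := Real.add_one_le_exp (1 : ℝ)
    nlinarith
  have hEqL : 1 ≤ E * q * L := by
    have h1 : 1 ≤ E * q := one_le_mul_of_one_le_of_one_le hE1 hq1
    exact one_le_mul_of_one_le_of_one_le h1 hL1
  have hframe : ∀ k : Fin (d + 1), HasUncondFrame (walshSpace (level 𝒮 k)) (E * q * L) := by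
    intro k
    rcases Nat.eq_zero_or_pos (k : ℕ) with h0 | hpos
    · rw [h0]
      exact (hasUncondFrame_level_zero 𝒮).mono hEqL
    · have hkm : (k : ℕ) ∈ Finset.Icc 1 d := Finset.mem_Icc.2 ⟨hpos, Nat.lt_succ_iff.1 k.2⟩
      obtain ⟨P, h1, h2, h3⟩ := exists_projection_of_projConst_lt (hLk _ hkm)
      refine (hasUncondFrame_homogeneous hpos (hcard k) P h1 h2 (by linarith) h3).mono ?_
      have h4 := hQq _ hkm
      have h5 : (2 * √2) ^ (k : ℕ) ≤ (2 * √2) ^ d :=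
        pow_le_pow_right₀ h22 (Nat.lt_succ_iff.1 k.2)
      rw [hE]
      gcongr
  refine (glConst_le_of_frame (by positivity)
    (hasUncondFrame_of_levels h𝒮 (fun _ => by positivity) hframe)).trans ?_
  rw [← ENNReal.ofReal_mul (by positivity)]
  refine ENNReal.ofReal_le_ofReal ?_
  rw [Finset.sum_const, Finset.card_univ, Fintype.card_fin, nsmul_eq_mul]
  push_cast
  have hEd : E ≤ 2 * d * kappa ^ d * 2 ^ d := by
    refine (exp_one_mul_pow_le hd).trans ?_
    have : 0 ≤ d * kappa ^ d * 2 ^ d := by positivity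
    linarith
  calc (1 + √2) ^ d * ((d + 1) * (E * q * L))
      ≤ (1 + √2) ^ d * ((d + 1) * (2 * d * kappa ^ d * 2 ^ d * q * L)) := by gcongr
    _ = _ := by ring

end Main

end BooleanCube

theorem theorem5p7 (d N : ℕ) (hd : 2 ≤ d) (hdN : d ≤ N)
    (𝒮 : Finset (Finset (Fin N))) :
    ((∀ S ∈ 𝒮, S.card = d) →
      BooleanCube.glConst (BooleanCube.walshSpace 𝒮) ≤
        ENNReal.ofReal (2 * d * BooleanCube.kappa ^ d * 2 ^ (d - 1)) *
          ‖BooleanCube.coeffProj (BooleanCube.homog N d) 𝒮‖ₑ *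
          BooleanCube.projConst (BooleanCube.walshSpace (BooleanCube.flat 𝒮))) ∧
    ((∀ S ∈ 𝒮, S.card ≤ d) → 𝒮 ≠ {∅} →
      BooleanCube.glConst (BooleanCube.walshSpace 𝒮) ≤
        ENNReal.ofReal ((d + 1) * (1 + √2) ^ d * (2 * d) * BooleanCube.kappa ^ d * 2 ^ d) *
          (⨆ k ∈ Finset.Icc 1 d,
            ‖BooleanCube.coeffProj (BooleanCube.homog N k) (BooleanCube.level 𝒮 k)‖ₑ) *
          (⨆ k ∈ Finset.Icc 1 d,
            BooleanCube.projConst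
              (BooleanCube.walshSpace (BooleanCube.flat (BooleanCube.level 𝒮 k))))) :=
  ⟨fun h => BooleanCube.glConst_le_homogeneous hd h,
    fun h hne => BooleanCube.glConst_le_of_card_le hd h hne⟩
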